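/- Let $n,q,d\ge 1$ and $1\le m\le N:=qd$ be integers. Let $X_1,\dots,X_n$ ($\mathbb R^d$-valued), $\eta_1,\dots,\eta_n$ and $Y_1,\dots,Y_n$ ($\mathbb R^q$-valued) be random vectors with $$Y_t=A_*X_t+\eta_t\quad(1\le t\le n),$$ where $A_*\in\mathbb R^{q\times d}$, and put $\mathcal F_t=\sigma(\eta_1,\dots,\eta_{t-1},X_1,\dots,X_t)$ ($\mathcal F_0$ is trivial) and $\beta_*=\mathrm{vec}(A_*^{\mathsf T})\in\mathbb R^N$. Suppose that $\mathcal C\beta_*=\mu$, where $\mathcal C\in\mathbb R^{(N-m)\times N}$ has rank $N-m$ and $\mu\in\mathbb R^{N-m}$. Let $\mathcal C_+\in\mathbb R^{m\times N}$ be such that $\mathcal C_{\rm full}=(\mathcal C_+^{\mathsf T},\mathcal C^{\mathsf T})^{\mathsf T}$ is invertible, write $\mathcal C_{\rm full}^{-1}=(R,R_+)$ with $R\in\mathbb R^{N\times m}$, and set $\gamma=R_+\mu$. Let $X=(X_1,\dots,X_n)^{\mathsf T}$, $Y=(Y_1,\dots,Y_n)^{\mathsf T}$, $Z=(I_q\otimes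 X)R$ and $\widetilde y=\mathrm{vec}(Y)-(I_q\otimes X)\gamma$. An ordinary least squares estimator is $$\widehat\beta=R\widehat\theta+\gamma,\qquad \widehat\theta\in\arg\min_{\theta\in\mathbb R^m}\|\widetilde y-Z\theta\|^2 .$$ Let $\delta\in(0,1)$, $\alpha\in(0,1)$, $\sigma\ge 0$, let $k\ge1$ be an integer, let $\Gamma_{\rm sb},\overline\Gamma\in\mathbb R^{d\times d}$ be symmetric with $0\prec\Gamma_{\rm sb}\preceq\overline\Gamma$, and set $\underline\Gamma_R=R^{\mathsf T}(I_q\otimes\Gamma_{\rm sb})R$ and $\overline\Gamma_R=R^{\mathsf T}(I_q\otimes\overline\Gamma)R$. Assume: 1. ($(k,\Gamma_{\rm sb},\alpha)$ block martingale small-ball condition) for every $w\in\mathbb R^d$ with $\|w\|=1$ and every integer $s\ge0$ with $s+k\le n$, almost surely $$\frac1k\sum_{t=1}^k\Pr\bigl(|w^{\mathsf T}X_{s+t}|\ge (w^{\mathsf T}\Gamma_{\rm sb}w)^{1/2}\,\big|\,\mathcal F_s\bigr)\ge\alpha ;$$ 2. $\Pr(Z^{\mathsf T}Z\preceq n\overline\Gamma_R)\ge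 1-\delta$; 3. for $1\le t\le n$, conditionally on $\mathcal F_t$ the vector $\eta_t$ is mean-zero and $\sigma^2$-sub-Gaussian, i.e. $E(\eta_t\mid\mathcal F_t)=0$ and, for every $u\in\mathbb R^q$, $E(e^{u^{\mathsf T}\eta_t}\mid\mathcal F_t)\le e^{\sigma^2\|u\|^2/2}$ almost surely; 4. $\displaystyle n\ge\frac{9k}{\alpha^2}\Bigl\{m\log\frac{27}{\alpha}+\frac12\log\det(\overline\Gamma_R\underline\Gamma_R^{-1})+\log q+\log\frac1\delta\Bigr\}.$ Then, with probability at least $1-3\delta$, every ordinary least squares estimator $\widehat\beta$ satisfies $$\|\widehat\beta-\beta_*\|\le\frac{9\sigma}{\alpha}\left[\frac{\lambda_{\max}(R\,\underline\Gamma_R^{-1}R^{\mathsf T})}{n}\Bigl\{12m\log\frac{14}{\alpha}+9\log\det(\overline\Gamma_R\underline\Gamma_R^{-1})+6\log\frac1\delta\Bigr\}\right]^{1/2},$$ where $\lambda_{\max}$ denotes the largest eigenvalue and $\|\cdot\|$ the Euclidean norm. -/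

import Mathlib

open MeasureTheory ProbabilityTheory Matrix
open scoped Kronecker

namespace RestrictedRegression

noncomputable section

/-- Euclidean norm of a real vector indexed by a finite type. -/
def euclNorm {ι : Type*} [Fintype ι] (v : ι → ℝ) : ℝ := ‖WithLp.toLp 2 v‖

/-- Largest eigenvalue of a real symmetric matrix. -/
def lambdaMax {ι : Type*} [Fintype ι] [DecidableEq ι] (A : Matrix ι ι ℝ) : ℝ :=
  sSup (spectrum ℝ A)

/-- The filtration `F_t = σ(η_1, …, η_{t-1}, X_1, …, X_t)`; in particular `F_0` is trivial.
Processes are indexed by `ℕ` and only the times `t ≥ 1` are used. -/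
def dataFiltration {Ω : Type*} [mΩ : MeasurableSpace Ω] {d q : ℕ}
    (X : ℕ → Ω → Fin d → ℝ) (η : ℕ → Ω → Fin q → ℝ)
    (hX : ∀ t, Measurable (X t)) (hη : ∀ t, Measurable (η t)) : Filtration ℕ mΩ where
  seq t := (⨆ i ∈ Set.Ico 1 t, MeasurableSpace.comap (η i) inferInstance) ⊔
    (⨆ i ∈ Set.Icc 1 t, MeasurableSpace.comap (X i) inferInstance)
  mono' _ _ hst := sup_le_sup
    (biSup_mono fun _ hi => ⟨hi.1, lt_of_lt_of_le hi.2 hst⟩)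
    (biSup_mono fun _ hi => ⟨hi.1, le_trans hi.2 hst⟩)
  le' _ := sup_le (iSup₂_le fun i _ => (hη i).comap_le) (iSup₂_le fun i _ => (hX i).comap_le)

/-- The `(k, ν, α)` block martingale small ball condition for a real-valued time series
`x_1, …, x_n` adapted to a filtration `F`. The starting point `s ≥ 0` ranges over all
blocks `s + 1, …, s + k` inside the horizon `n`. -/
def IsBMSB {Ω : Type*} [mΩ : MeasurableSpace Ω] (P : Measure Ω) (F : Filtration ℕ mΩ)
    (n k : ℕ) (ν α : ℝ) (x : ℕ → Ω → ℝ) : Prop :=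
  1 ≤ k ∧ 0 < ν ∧ 0 < α ∧ α < 1 ∧ (∀ t ∈ Finset.Icc 1 n, Measurable[F t] (x t)) ∧
    ∀ s : ℕ, s + k ≤ n → ∀ᵐ ω ∂P,
      α ≤ (k : ℝ)⁻¹ * ∑ t ∈ Finset.Icc 1 k, (P⟦{ω' | ν ≤ |x (s + t) ω'|} | F s⟧) ω

/-- The `(k, Γ, α)` block martingale small ball condition for a time series in `ℝ^d`. -/
def IsVectorBMSB {Ω : Type*} [mΩ : MeasurableSpace Ω] (P : Measure Ω) (F : Filtration ℕ mΩ)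
    {d : ℕ} (n k : ℕ) (Γ : Matrix (Fin d) (Fin d) ℝ) (α : ℝ) (X : ℕ → Ω → Fin d → ℝ) : Prop :=
  1 ≤ k ∧ 0 < α ∧ α < 1 ∧ Γ.PosDef ∧ ∀ w : Fin d → ℝ, euclNorm w = 1 →
    IsBMSB P F n k (√(w ⬝ᵥ Γ *ᵥ w)) α (fun t ω => w ⬝ᵥ X t ω)

/-- Conditionally on the sub-σ-algebra `m`, the random vector `ξ` is mean-zero and
`σ²`-sub-Gaussian: `E[exp(uᵀξ) | m] ≤ exp(σ²‖u‖²/2)` almost surely, for every `u`. -/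
def IsCondCenteredSubGaussian {Ω : Type*} [MeasurableSpace Ω] (P : Measure Ω)
    (m : MeasurableSpace Ω) {q : ℕ} (σ : ℝ) (ξ : Ω → Fin q → ℝ) : Prop :=
  ∀ u : Fin q → ℝ,
    Integrable (fun ω => u ⬝ᵥ ξ ω) P ∧
    P[fun ω => u ⬝ᵥ ξ ω | m] =ᵐ[P] 0 ∧
    Integrable (fun ω => Real.exp (u ⬝ᵥ ξ ω)) P ∧
    ∀ᵐ ω ∂P, (P[fun ω' => Real.exp (u ⬝ᵥ ξ ω') | m]) ω ≤
      Real.exp (σ ^ 2 * euclNorm u ^ 2 / 2)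

/-- `C` has full row rank, `Cplus` is a complement of `C`, and `(R, Rplus)` is the inverse of
the invertible matrix obtained by stacking `Cplus` on top of `C`. -/
structure IsRestriction {q d m : ℕ}
    (C : Matrix (Fin (q * d - m)) (Fin q × Fin d) ℝ) (Cplus : Matrix (Fin m) (Fin q × Fin d) ℝ)
    (R : Matrix (Fin q × Fin d) (Fin m) ℝ)
    (Rplus : Matrix (Fin q × Fin d) (Fin (q * d - m)) ℝ) : Prop where
  rank_eq : C.rank = q * d - m
  full_mul_inv : fromRows Cplus C * fromCols R Rplus = 1
  inv_mul_full : fromCols R Rplus * fromRows Cplus C = 1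

/-- The matrix `(v_1, …, v_n)ᵀ` whose rows are the first `n` terms of a sequence of vectors. -/
def dataMatrix {p : ℕ} (n : ℕ) (v : ℕ → Fin p → ℝ) : Matrix (Fin n) (Fin p) ℝ :=
  Matrix.of fun t j => v (t + 1) j

/-- The design matrix `Z = (I_q ⊗ X) R`. -/
def designMatrix {n q d m : ℕ} (X : Matrix (Fin n) (Fin d) ℝ)
    (R : Matrix (Fin q × Fin d) (Fin m) ℝ) : Matrix (Fin q × Fin n) (Fin m) ℝ :=
  ((1 : Matrix (Fin q) (Fin q) ℝ) ⊗ₖ X) * R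

/-- The matrix `Γ_R = Rᵀ (I_q ⊗ Γ) R`. -/
def restrictedGram {q d m : ℕ} (Γ : Matrix (Fin d) (Fin d) ℝ)
    (R : Matrix (Fin q × Fin d) (Fin m) ℝ) : Matrix (Fin m) (Fin m) ℝ :=
  Rᵀ * ((1 : Matrix (Fin q) (Fin q) ℝ) ⊗ₖ Γ) * R

/-- `b` is an ordinary least squares estimate for the data `X`, `Y` under the restriction
`β ∈ {R θ + γ}`: `b = R θ + γ` for a minimizer `θ` of `‖ỹ - Z θ‖²`, where
`ỹ = vec(Y) - (I_q ⊗ X) γ`. -/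
def IsOLS {n q d m : ℕ} (X : Matrix (Fin n) (Fin d) ℝ) (Y : Matrix (Fin n) (Fin q) ℝ)
    (R : Matrix (Fin q × Fin d) (Fin m) ℝ) (γ : Fin q × Fin d → ℝ)
    (b : Fin q × Fin d → ℝ) : Prop :=
  ∃ θ : Fin m → ℝ, b = R *ᵥ θ + γ ∧ ∀ θ' : Fin m → ℝ,
    euclNorm (vec Y - ((1 : Matrix (Fin q) (Fin q) ℝ) ⊗ₖ X) *ᵥ γ - designMatrix X R *ᵥ θ) ^ 2 ≤
    euclNorm (vec Y - ((1 : Matrix (Fin q) (Fin q) ℝ) ⊗ₖ X) *ᵥ γ - designMatrix X R *ᵥ θ') ^ 2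

end

end RestrictedRegression

/-!
Write `Z` for the design matrix, `G = Zᵀ Z`, `S = Zᵀ vec(η)`, and let `A ≤ B` be the restricted Gram
matrices of `Γsb` and `Γbar`. A least squares estimate errs by `R u` with `uᵀ G u = uᵀ S`
(`IsOLS.exists_dotProduct_eq`), and `‖R u‖² ≤ λ_max(R A⁻¹ Rᵀ) uᵀ A u` (`dotProduct_self_mulVec_le`).
It is therefore enough to bound `uᵀ A u`, which follows from two estimates on the event `G ≤ n B`,
each failing with probability at most `δ`.

*Excitation*: `G ≥ V := (α² n / 100) A`. For a fixed direction the block small-ball condition yields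
an exponential lower tail for the quadratic form of `G` (`measure_gram_le`). The statistic of a
block averages over the `q` rows of the coefficient matrix with weights proportional to their share of the
form of `A`, which avoids a union bound over the rows. Uniformity over directions comes from a
volume argument in place of a net (`measure_not_lower_le`): around a direction in which `G` is too small
there is a whole ellipsoid of directions in which it is too small, and the expected volume of such
directions is controlled by Fubini. The determinant of `B A⁻¹` enters as a ratio of volumes of
ellipsoids.

*Noise*: `2 wᵀ S - wᵀ (G + V) w ≤ σ² (2 log (1/δ) + log det (W V⁻¹))` for all `w`, where
`W = (α² / 100 + 1) n B`. The process `exp (vᵀ S - σ² vᵀ G v / 2)` is built from a supermartingale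
(`lintegral_exp_sum_le_one`), and mixing over a Gaussian `v` with precision `σ² V`
gives the self-normalized bound (`measure_selfNormalized_le`). The determinant enters as a ratio of
Gaussian integrals.

Choosing `w = u / 2` and using `V ≤ G` gives
`uᵀ V u ≤ uᵀ G u ≤ 2 σ² (2 log (1/δ) + log det (W V⁻¹))`.
-/

namespace RestrictedRegression

/-! ### Quadratic forms -/

open scoped MatrixOrder in
theorem exists_transpose_mul_self_eq {m : ℕ} {A : Matrix (Fin m) (Fin m) ℝ} (hA : A.PosDef) :
    ∃ a : Matrix (Fin m) (Fin m) ℝ, A = aᵀ * a ∧ IsUnit a.det := by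
  obtain ⟨a, ha⟩ := CStarAlgebra.nonneg_iff_eq_star_mul_self.mp hA.posSemidef.nonneg
  have ha' : A = aᵀ * a := by rw [ha, star_eq_conjTranspose, conjTranspose_eq_transpose_of_trivial]
  refine ⟨a, ha', ?_⟩
  have := hA.det_pos
  rw [ha', det_mul, det_transpose] at this
  exact isUnit_iff_ne_zero.mpr fun h => by simp [h] at this

/-- Two positive definite forms are related by an invertible linear substitution, whose squared
determinant is the ratio of the two determinants. -/
theorem exists_congruence {m : ℕ} {A B : Matrix (Fin m) (Fin m) ℝ} (hA : A.PosDef)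
    (hB : B.PosDef) :
    ∃ T : Matrix (Fin m) (Fin m) ℝ, (∀ x, x ⬝ᵥ B *ᵥ x = (T *ᵥ x) ⬝ᵥ A *ᵥ (T *ᵥ x)) ∧
      T.det ≠ 0 ∧ T.det ^ 2 = (B * A⁻¹).det := by
  obtain ⟨a, hA', ha⟩ := exists_transpose_mul_self_eq hA
  obtain ⟨b, hB', hb⟩ := exists_transpose_mul_self_eq hB
  refine ⟨a⁻¹ * b, fun x => ?_, ?_, ?_⟩
  · have h : a *ᵥ ((a⁻¹ * b) *ᵥ x) = b *ᵥ x := by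
      rw [mulVec_mulVec, ← Matrix.mul_assoc, mul_nonsing_inv _ ha, Matrix.one_mul]
    have hq : ∀ (c : Matrix (Fin m) (Fin m) ℝ) y, y ⬝ᵥ (cᵀ * c) *ᵥ y = (c *ᵥ y) ⬝ᵥ (c *ᵥ y) :=
      fun c y => by rw [← mulVec_mulVec, dotProduct_mulVec, vecMul_transpose]
    rw [hA', hB', hq, hq, h]
  · rw [det_mul, det_nonsing_inv]
    exact mul_ne_zero (by simpa using ha.ne_zero) hb.ne_zero
  · have h0 := ha.ne_zero
    rw [det_mul, det_mul, det_nonsing_inv, det_nonsing_inv, hA', hB', det_mul, det_mul,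
      det_transpose, det_transpose]
    simp only [Ring.inverse_eq_inv']
    field_simp

theorem lintegral_comp_mulVec {m : ℕ} {T : Matrix (Fin m) (Fin m) ℝ} (hT : T.det ≠ 0)
    {f : (Fin m → ℝ) → ENNReal} (hf : Measurable f) :
    ∫⁻ x, f (T *ᵥ x) = ENNReal.ofReal |T.det|⁻¹ * ∫⁻ x, f x := by
  have h := Real.map_matrix_volume_pi_eq_smul_volume_pi hT
  have hm : Measurable (toLin' T) := (toLin' T).continuous_of_finiteDimensional.measurable
  rw [← abs_inv, ← smul_eq_mul, ← lintegral_smul_measure, ← h, lintegral_map hf hm]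
  simp [toLin'_apply]

theorem dotProduct_self_eq {ι : Type*} [Fintype ι] (x : ι → ℝ) :
    x ⬝ᵥ x = euclNorm x ^ 2 := by
  rw [euclNorm, EuclideanSpace.real_norm_sq_eq]
  simp [dotProduct, sq]

theorem dotProduct_mulVec_le_lambdaMax {ι : Type*} [Fintype ι] [DecidableEq ι]
    {A : Matrix ι ι ℝ} (hA : A.IsHermitian) (x : ι → ℝ) :
    x ⬝ᵥ A *ᵥ x ≤ lambdaMax A * (x ⬝ᵥ x) := by
  have hbdd : BddAbove (spectrum ℝ A) := A.finite_real_spectrum.bddAbove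
  have h : (lambdaMax A • (1 : Matrix ι ι ℝ) - A).PosSemidef := by
    have hH : (lambdaMax A • (1 : Matrix ι ι ℝ) - A).IsHermitian := by
      refine IsHermitian.sub ?_ hA
      simp [IsHermitian]
    rw [posSemidef_iff_isHermitian_and_spectrum_nonneg]
    refine ⟨hH, ?_⟩
    intro a ha
    have : lambdaMax A - a ∈ spectrum ℝ A := by
      rw [← Algebra.algebraMap_eq_smul_one] at ha
      rw [← spectrum.singleton_sub_eq] at ha
      obtain ⟨b, hb, c, hc, rfl⟩ := ha
      simp only [Set.mem_singleton_iff] at hb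
      subst hb
      simpa using hc
    have := le_csSup hbdd this
    simp only [lambdaMax] at this ⊢
    simp only [Set.mem_ofPred_eq]
    linarith
  have := h.dotProduct_mulVec_nonneg x
  simp only [star_trivial, sub_mulVec, smul_mulVec, one_mulVec, dotProduct_sub,
    dotProduct_smul, smul_eq_mul] at this
  linarith

theorem lambdaMax_nonneg {ι : Type*} [Fintype ι] [DecidableEq ι] {m : ℕ}
    (R : Matrix ι (Fin m) ℝ) {Γ : Matrix (Fin m) (Fin m) ℝ} (hΓ : Γ.PosDef) :
    0 ≤ lambdaMax (R * Γ⁻¹ * Rᵀ) := by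
  have hP : (R * Γ⁻¹ * Rᵀ).PosSemidef := by
    simpa using hΓ.inv.posSemidef.mul_mul_conjTranspose_same R
  exact Real.sSup_nonneg (posSemidef_iff_isHermitian_and_spectrum_nonneg.mp hP).2

theorem dotProduct_mulVec_comm {ι : Type*} [Fintype ι] {A : Matrix ι ι ℝ} (hA : A.IsHermitian)
    (x y : ι → ℝ) : x ⬝ᵥ A *ᵥ y = y ⬝ᵥ A *ᵥ x := by
  rw [dotProduct_mulVec, ← mulVec_transpose, dotProduct_comm]
  congr 2

theorem dotProduct_mulVec_add {ι : Type*} [Fintype ι] {A : Matrix ι ι ℝ} (hA : A.IsHermitian)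
    (x y : ι → ℝ) (s : ℝ) : (x + s • y) ⬝ᵥ A *ᵥ (x + s • y) =
      x ⬝ᵥ A *ᵥ x + 2 * s * (x ⬝ᵥ A *ᵥ y) + s ^ 2 * (y ⬝ᵥ A *ᵥ y) := by
  have := dotProduct_mulVec_comm hA x y
  simp only [mulVec_add, mulVec_smul, dotProduct_add, add_dotProduct, smul_dotProduct,
    dotProduct_smul, smul_eq_mul]
  rw [this]; ring

/-- Cauchy–Schwarz in the `Γ` geometry turns an operator bound for `R Γ⁻¹ Rᵀ` into a bound of
`‖R u‖²` by the form `uᵀ Γ u`. -/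
theorem dotProduct_self_mulVec_le {ι : Type*} [Fintype ι] [DecidableEq ι] {m : ℕ}
    (R : Matrix ι (Fin m) ℝ) {Γ : Matrix (Fin m) (Fin m) ℝ} (hΓ : Γ.PosDef) (u : Fin m → ℝ) :
    (R *ᵥ u) ⬝ᵥ (R *ᵥ u) ≤ lambdaMax (R * Γ⁻¹ * Rᵀ) * (u ⬝ᵥ Γ *ᵥ u) := by
  set x := R *ᵥ u with hx
  set y := Rᵀ *ᵥ x with hy
  have hA : (R * Γ⁻¹ * Rᵀ).IsHermitian := by
    have := isHermitian_mul_mul_conjTranspose R hΓ.inv.isHermitian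
    simpa using this
  have h1 := dotProduct_mulVec_le_lambdaMax hA x
  have e1 : x ⬝ᵥ (R * Γ⁻¹ * Rᵀ) *ᵥ x = y ⬝ᵥ Γ⁻¹ *ᵥ y := by
    rw [← mulVec_mulVec, ← mulVec_mulVec, ← hy, dotProduct_mulVec, hy, mulVec_transpose]
  have e2 : u ⬝ᵥ y = x ⬝ᵥ x := by
    rw [hy, dotProduct_mulVec, vecMul_transpose]
  have hu : IsUnit Γ.det := hΓ.det_pos.ne'.isUnit
  have e3 : Γ *ᵥ (Γ⁻¹ *ᵥ y) = y := by
    rw [mulVec_mulVec, mul_nonsing_inv _ hu, one_mulVec]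
  have key : ∀ s : ℝ, 0 ≤ u ⬝ᵥ Γ *ᵥ u + 2 * s * (x ⬝ᵥ x) + s ^ 2 * (y ⬝ᵥ Γ⁻¹ *ᵥ y) := by
    intro s
    have := hΓ.posSemidef.dotProduct_mulVec_nonneg (u + s • (Γ⁻¹ *ᵥ y))
    rw [star_trivial, dotProduct_mulVec_add hΓ.isHermitian, e3, e2, dotProduct_comm _ y] at this
    exact this
  rw [e1] at h1
  have hd := discrim_le_zero (a := y ⬝ᵥ Γ⁻¹ *ᵥ y) (b := 2 * (x ⬝ᵥ x)) (c := u ⬝ᵥ Γ *ᵥ u)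
    (fun s => by have := key s; linarith)
  rw [discrim] at hd
  have hu0 : 0 ≤ u ⬝ᵥ Γ *ᵥ u := by simpa using hΓ.posSemidef.dotProduct_mulVec_nonneg u
  have hx0 : 0 ≤ x ⬝ᵥ x := by rw [dotProduct_self_eq]; positivity
  rcases hx0.eq_or_lt with h0 | h0
  · have : x = 0 := by simpa using h0.symm
    have hl := lambdaMax_nonneg R hΓ
    rw [← h0]
    positivity
  · have h2 := mul_le_mul_of_nonneg_right h1 hu0
    refine le_of_mul_le_mul_left ?_ h0
    nlinarith

/-! ### Gaussian integrals and volumes of ellipsoids -/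

theorem continuous_dotProduct_mulVec {ι : Type*} [Fintype ι] (A : Matrix ι ι ℝ) :
    Continuous fun x : ι → ℝ => x ⬝ᵥ A *ᵥ x := by
  fun_prop

/-- Gaussian integrals and volumes of ellipsoids for two positive definite forms differ by the
factor `det (B * A⁻¹) ^ (-1/2)`. -/
theorem lintegral_comp_quadratic {m : ℕ} {A B : Matrix (Fin m) (Fin m) ℝ} (hA : A.PosDef)
    (hB : B.PosDef) {g : ℝ → ENNReal} (hg : Measurable g) :
    ∫⁻ x : Fin m → ℝ, g (x ⬝ᵥ B *ᵥ x) =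
      ENNReal.ofReal (√(B * A⁻¹).det)⁻¹ * ∫⁻ x : Fin m → ℝ, g (x ⬝ᵥ A *ᵥ x) := by
  obtain ⟨T, h, h0, hd⟩ := exists_congruence hA hB
  rw [← hd, Real.sqrt_sq_eq_abs]
  simp only [h]
  exact lintegral_comp_mulVec h0 (hg.comp (continuous_dotProduct_mulVec A).measurable)

theorem volume_ellipsoid_pos {m : ℕ} {A : Matrix (Fin m) (Fin m) ℝ} :
    0 < volume {x : Fin m → ℝ | x ⬝ᵥ A *ᵥ x ≤ 1} := by
  have ho : IsOpen {x : Fin m → ℝ | x ⬝ᵥ A *ᵥ x < 1} :=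
    isOpen_lt (continuous_dotProduct_mulVec A) continuous_const
  refine (ho.measure_pos volume ⟨0, by simp⟩).trans_le (measure_mono fun x hx => ?_)
  exact le_of_lt (Set.mem_ofPred_eq ▸ hx)

theorem volume_ellipsoid_eq {m : ℕ} {A B : Matrix (Fin m) (Fin m) ℝ} (hA : A.PosDef)
    (hB : B.PosDef) :
    volume {x : Fin m → ℝ | x ⬝ᵥ B *ᵥ x ≤ 1} =
      ENNReal.ofReal (√(B * A⁻¹).det)⁻¹ * volume {x : Fin m → ℝ | x ⬝ᵥ A *ᵥ x ≤ 1} := by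
  have hm : ∀ C : Matrix (Fin m) (Fin m) ℝ, MeasurableSet {x : Fin m → ℝ | x ⬝ᵥ C *ᵥ x ≤ 1} :=
    fun C => measurableSet_le (continuous_dotProduct_mulVec C).measurable measurable_const
  have := lintegral_comp_quadratic hA hB
    (g := (Set.Iic (1 : ℝ)).indicator 1) (measurable_one.indicator measurableSet_Iic)
  rw [← lintegral_indicator_one (hm A), ← lintegral_indicator_one (hm B)]
  exact this

theorem volume_ellipsoid_lt_top {m : ℕ} {A : Matrix (Fin m) (Fin m) ℝ} (hA : A.PosDef) :
    volume {x : Fin m → ℝ | x ⬝ᵥ A *ᵥ x ≤ 1} < ⊤ := by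
  rw [volume_ellipsoid_eq PosDef.one hA]
  refine ENNReal.mul_lt_top ENNReal.ofReal_lt_top
    ((measure_mono ?_).trans_lt (measure_closedBall_lt_top (x := (0 : Fin m → ℝ)) (r := 1)))
  intro x hx
  simp only [one_mulVec, Set.mem_ofPred_eq] at hx
  rw [mem_closedBall_zero_iff, pi_norm_le_iff_of_nonneg zero_le_one]
  intro i
  have h1 : x i * x i ≤ x ⬝ᵥ x :=
    Finset.single_le_sum (f := fun i => x i * x i) (fun i _ => mul_self_nonneg _)
      (Finset.mem_univ i)
  rw [Real.norm_eq_abs]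
  exact abs_le_one_iff_mul_self_le_one.mpr (h1.trans hx)

theorem lintegral_gaussian_lt_top {m : ℕ} {A : Matrix (Fin m) (Fin m) ℝ} (hA : A.PosDef) {s : ℝ}
    (hs : 0 < s) : ∫⁻ x : Fin m → ℝ, ENNReal.ofReal (Real.exp (-s * (x ⬝ᵥ A *ᵥ x))) < ⊤ := by
  rw [lintegral_comp_quadratic PosDef.one hA (g := fun y => ENNReal.ofReal (Real.exp (-s * y)))
    (by fun_prop)]
  refine ENNReal.mul_lt_top ENNReal.ofReal_lt_top ?_
  have h : Integrable fun x : Fin m → ℝ => ∏ i, Real.exp (-s * x i ^ 2) :=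
    Integrable.fintype_prod (f := fun _ y => Real.exp (-s * y ^ 2))
      fun _ => integrable_exp_neg_mul_sq hs
  convert! h.lintegral_lt_top using 4 with x
  rw [← Real.exp_sum, ← Finset.mul_sum]
  simp [dotProduct, sq]

theorem lintegral_gaussian_pos {m : ℕ} {A : Matrix (Fin m) (Fin m) ℝ} {s : ℝ} :
    0 < ∫⁻ x : Fin m → ℝ, ENNReal.ofReal (Real.exp (-s * (x ⬝ᵥ A *ᵥ x))) := by
  have hc := continuous_dotProduct_mulVec A
  rw [lintegral_pos_iff_support (by fun_prop)]
  have : (Function.support fun x : Fin m → ℝ =>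
      ENNReal.ofReal (Real.exp (-s * (x ⬝ᵥ A *ᵥ x)))) = Set.univ := by
    ext x; simp [Real.exp_pos]
  rw [this]
  exact isOpen_univ.measure_pos _ Set.univ_nonempty

/-- Loewner monotonicity of the determinant, read off the volumes of the unit ellipsoids. -/
theorem one_le_det_mul_inv {m : ℕ} {A B : Matrix (Fin m) (Fin m) ℝ} (hA : A.PosDef)
    (hB : B.PosDef) (hAB : (B - A).PosSemidef) : 1 ≤ (B * A⁻¹).det := by
  have hle : volume {x : Fin m → ℝ | x ⬝ᵥ B *ᵥ x ≤ 1} ≤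
      volume {x : Fin m → ℝ | x ⬝ᵥ A *ᵥ x ≤ 1} := by
    refine measure_mono fun x hx => ?_
    have := hAB.dotProduct_mulVec_nonneg x
    simp only [star_trivial, sub_mulVec, dotProduct_sub] at this
    simp only [Set.mem_ofPred_eq] at hx ⊢
    linarith
  rw [volume_ellipsoid_eq hA hB] at hle
  have h1 : ENNReal.ofReal (√(B * A⁻¹).det)⁻¹ ≤ 1 := by
    by_contra! h
    have := ENNReal.mul_lt_mul_left (volume_ellipsoid_pos (A := A)).ne'
      (volume_ellipsoid_lt_top hA).ne h
    rw [one_mul] at this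
    exact absurd hle this.not_ge
  have hd : 0 < (B * A⁻¹).det := by
    rw [det_mul, det_nonsing_inv, Ring.inverse_eq_inv']
    exact mul_pos hB.det_pos (inv_pos.mpr hA.det_pos)
  rw [ENNReal.ofReal_le_one, inv_le_one₀ (Real.sqrt_pos.mpr hd)] at h1
  simpa using h1

/-! ### Lower tails of sums of bounded variables -/

/-- A chord bound for the exponential; the slope `1/2` is below `1 - e⁻¹`. -/
theorem exp_neg_le_one_sub_half {x : ℝ} (h0 : 0 ≤ x) (h1 : x ≤ 1) :
    Real.exp (-x) ≤ 1 - x / 2 := by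
  have hconv := convexOn_exp.2 (Set.mem_univ 0) (Set.mem_univ (-1)) (sub_nonneg.mpr h1) h0
    (by ring)
  have he : Real.exp (-1) ≤ 1 / 2 := by
    rw [Real.exp_neg, inv_le_comm₀ (Real.exp_pos 1) (by norm_num)]
    have := Real.add_one_le_exp 1
    norm_num at this ⊢
    exact this
  simp only [smul_eq_mul, mul_zero, mul_neg, mul_one, zero_add, Real.exp_zero] at hconv
  nlinarith

/-- Laplace transform of a sum of `[0, 1]`-valued variables with conditional means at least `α`. -/
theorem integral_exp_neg_sum_le {Ω : Type*} [mΩ : MeasurableSpace Ω] {P : Measure Ω}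
    [IsProbabilityMeasure P] {F : ℕ → MeasurableSpace Ω} (hF : Monotone F) (hle : ∀ j, F j ≤ mΩ)
    {α : ℝ} {U : ℕ → Ω → ℝ} {B : ℕ} (hU : ∀ j < B, Measurable[F (j + 1)] (U j))
    (h0 : ∀ j < B, ∀ ω, 0 ≤ U j ω) (h1 : ∀ j < B, ∀ ω, U j ω ≤ 1)
    (hα : ∀ j < B, ∀ᵐ ω ∂P, α ≤ (P[U j | F j]) ω) :
    ∫ ω, Real.exp (-∑ j ∈ Finset.range B, U j ω) ∂P ≤ Real.exp (-(α * B / 2)) := by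
  induction B with
  | zero => simp
  | succ B ih =>
    specialize ih (fun j hj => hU j (hj.trans B.lt_succ_self))
      (fun j hj => h0 j (hj.trans B.lt_succ_self)) (fun j hj => h1 j (hj.trans B.lt_succ_self))
      (fun j hj => hα j (hj.trans B.lt_succ_self))
    set W : Ω → ℝ := fun ω => Real.exp (-∑ j ∈ Finset.range B, U j ω) with hW
    have hWF : Measurable[F B] W := by
      refine Real.measurable_exp.comp (Measurable.neg ?_)
      exact Finset.measurable_sum _ fun j hj =>
        (hU j ((Finset.mem_range.mp hj).trans B.lt_succ_self)).mono
          (hF (Finset.mem_range.mp hj)) le_rfl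
    have hW0 : ∀ ω, 0 ≤ W ω := fun ω => (Real.exp_pos _).le
    have hW1 : ∀ ω, W ω ≤ 1 := fun ω => by
      rw [hW, Real.exp_le_one_iff, neg_nonpos]
      exact Finset.sum_nonneg fun j hj => h0 j ((Finset.mem_range.mp hj).trans B.lt_succ_self) ω
    have hWm : Measurable W := hWF.mono (hle B) le_rfl
    have hUm : Measurable (U B) := (hU B B.lt_succ_self).mono (hle _) le_rfl
    have hU0 := h0 B B.lt_succ_self
    have hU1 := h1 B B.lt_succ_self
    have hWi : Integrable W P := Integrable.of_bound hWm.aestronglyMeasurable 1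
      (ae_of_all _ fun ω => by rw [Real.norm_of_nonneg (hW0 ω)]; exact hW1 ω)
    have hUi : Integrable (U B) P := Integrable.of_bound hUm.aestronglyMeasurable 1
      (ae_of_all _ fun ω => by rw [Real.norm_of_nonneg (hU0 ω)]; exact hU1 ω)
    have hWU : Integrable (W * U B) P := hUi.bdd_mul hWm.aestronglyMeasurable
      (ae_of_all _ fun ω => by rw [Real.norm_of_nonneg (hW0 ω)]; exact hW1 ω)
    have hpull : α * ∫ ω, W ω ∂P ≤ ∫ ω, (W * U B) ω ∂P := by
      rw [← integral_condExp (hle B) (f := W * U B), ← integral_const_mul]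
      have hce := condExp_mul_of_stronglyMeasurable_left (m := F B) hWF.stronglyMeasurable hWU hUi
      refine integral_mono_ae (hWi.const_mul α) integrable_condExp ?_
      filter_upwards [hce, hα B B.lt_succ_self] with ω h h'
      rw [h, Pi.mul_apply, mul_comm]
      exact mul_le_mul_of_nonneg_left h' (hW0 ω)
    have hpt : ∀ ω, Real.exp (-∑ j ∈ Finset.range (B + 1), U j ω) ≤
        W ω - (W * U B) ω / 2 := fun ω => by
      rw [Finset.sum_range_succ, neg_add, Real.exp_add, Pi.mul_apply]
      have := mul_le_mul_of_nonneg_left (exp_neg_le_one_sub_half (hU0 ω) (hU1 ω)) (hW0 ω)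
      rw [hW] at this ⊢
      linarith
    calc ∫ ω, Real.exp (-∑ j ∈ Finset.range (B + 1), U j ω) ∂P
        ≤ ∫ ω, (W ω - (W * U B) ω / 2) ∂P :=
          integral_mono_of_nonneg (ae_of_all _ fun ω => (Real.exp_pos _).le)
            (hWi.sub (hWU.div_const 2)) (ae_of_all _ hpt)
      _ = ∫ ω, W ω ∂P - (∫ ω, (W * U B) ω ∂P) / 2 := by
          rw [integral_sub hWi (hWU.div_const 2), integral_div]
      _ ≤ (1 - α / 2) * ∫ ω, W ω ∂P := by linarith
      _ ≤ Real.exp (-(α / 2)) * ∫ ω, W ω ∂P := by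
          refine mul_le_mul_of_nonneg_right ?_ (integral_nonneg hW0)
          have := Real.add_one_le_exp (-(α / 2))
          linarith
      _ ≤ Real.exp (-(α / 2)) * Real.exp (-(α * B / 2)) := by gcongr
      _ = Real.exp (-(α * (B + 1 : ℕ) / 2)) := by
          rw [← Real.exp_add]; congr 1; push_cast; ring

/-- Chernoff bound, at parameter `1`, for the lower tail of a sum of `[0, 1]`-valued variables whose
conditional means are at least `α`. -/
theorem measure_sum_le_le {Ω : Type*} [mΩ : MeasurableSpace Ω] {P : Measure Ω}
    [IsProbabilityMeasure P] {F : ℕ → MeasurableSpace Ω} (hF : Monotone F) (hle : ∀ j, F j ≤ mΩ)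
    {α : ℝ} {U : ℕ → Ω → ℝ} {B : ℕ} (hU : ∀ j < B, Measurable[F (j + 1)] (U j))
    (h0 : ∀ j < B, ∀ ω, 0 ≤ U j ω) (h1 : ∀ j < B, ∀ ω, U j ω ≤ 1)
    (hα : ∀ j < B, ∀ᵐ ω ∂P, α ≤ (P[U j | F j]) ω) (a : ℝ) :
    P {ω | ∑ j ∈ Finset.range B, U j ω ≤ a} ≤ ENNReal.ofReal (Real.exp (a - α * B / 2)) := by
  have hm : Measurable fun ω => ∑ j ∈ Finset.range B, U j ω :=
    Finset.measurable_sum _ fun j hj => (hU j (Finset.mem_range.mp hj)).mono (hle _) le_rfl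
  have hi : Integrable (fun ω => Real.exp (-1 * ∑ j ∈ Finset.range B, U j ω)) P := by
    refine Integrable.of_bound (Real.measurable_exp.comp (hm.const_mul _)).aestronglyMeasurable
      1 (ae_of_all _ fun ω => ?_)
    rw [Real.norm_of_nonneg (Real.exp_pos _).le, Real.exp_le_one_iff]
    have := Finset.sum_nonneg fun j hj => h0 j (Finset.mem_range.mp hj) ω
    linarith
  have h := measure_le_le_exp_mul_mgf (μ := P) a (t := -1) (by norm_num) hi
  rw [← ENNReal.ofReal_toReal (measure_ne_top P _)]
  refine ENNReal.ofReal_le_ofReal (h.trans ?_)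
  have := integral_exp_neg_sum_le hF hle hU h0 h1 hα
  rw [mgf, sub_eq_add_neg, Real.exp_add]
  simp only [neg_neg, one_mul, neg_mul]
  gcongr

/-! ### Exponential supermartingales -/

section SelfNormalized

variable {Ω : Type*} {m : MeasurableSpace Ω} [mΩ : MeasurableSpace Ω] {P : Measure Ω}
  [IsProbabilityMeasure P] {q : ℕ} {σ : ℝ} {ξ : Ω → Fin q → ℝ}

/-- The conditional moment generating function bound, tested against a nonnegative `m`-measurable
weight. It is an inequality between two measures restricted to `m`, so the weight need not be
integrable. -/
theorem lintegral_mul_exp_const_le (hm : m ≤ mΩ) (hξ : IsCondCenteredSubGaussian P m σ ξ)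
    (hξm : Measurable ξ) {H : Ω → ENNReal} (hH : Measurable[m] H) (u : Fin q → ℝ) :
    ∫⁻ ω, H ω * ENNReal.ofReal (Real.exp (u ⬝ᵥ ξ ω - σ ^ 2 / 2 * (u ⬝ᵥ u))) ∂P ≤
      ∫⁻ ω, H ω ∂P := by
  obtain ⟨-, -, hint, hexp⟩ := hξ u
  have hfm : Measurable fun ω => u ⬝ᵥ ξ ω := by
    simp only [dotProduct]; fun_prop
  set f : Ω → ENNReal := fun ω =>
    ENNReal.ofReal (Real.exp (u ⬝ᵥ ξ ω - σ ^ 2 / 2 * (u ⬝ᵥ u))) with hf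
  have hfm' : Measurable f := by fun_prop
  have hle : (P.withDensity f).trim hm ≤ P.trim hm := by
    rw [Measure.le_iff]
    intro s hs
    rw [trim_measurableSet_eq hm hs, trim_measurableSet_eq hm hs, withDensity_apply _ (hm s hs)]
    have hi : Integrable (fun ω => Real.exp (u ⬝ᵥ ξ ω - σ ^ 2 / 2 * (u ⬝ᵥ u))) P := by
      simp only [Real.exp_sub]
      exact hint.div_const _
    rw [← ofReal_integral_eq_lintegral_ofReal hi.integrableOn
      (ae_of_all _ fun ω => (Real.exp_pos _).le)]
    simp only [Real.exp_sub]
    rw [integral_div, ← setIntegral_condExp hm hint hs]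
    have h1 : ∫ ω in s, (P[fun ω' => Real.exp (u ⬝ᵥ ξ ω') | m]) ω ∂P ≤
        ∫ ω in s, Real.exp (σ ^ 2 / 2 * (u ⬝ᵥ u)) ∂P := by
      refine integral_mono_ae integrable_condExp.integrableOn (integrable_const _) ?_
      refine ae_restrict_of_ae ?_
      filter_upwards [hexp] with ω h
      refine h.trans (le_of_eq ?_)
      rw [dotProduct_self_eq]; congr 1; ring
    rw [setIntegral_const, smul_eq_mul] at h1
    refine (ENNReal.ofReal_le_ofReal
      ((div_le_iff₀ (Real.exp_pos _)).mpr h1)).trans ?_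
    rw [Measure.real, ENNReal.ofReal_toReal (measure_ne_top _ _)]
  calc ∫⁻ ω, H ω * f ω ∂P = ∫⁻ ω, H ω ∂(P.withDensity f) := by
        rw [lintegral_withDensity_eq_lintegral_mul _ hfm' (hH.mono hm le_rfl)]
        simp [mul_comm]
    _ = ∫⁻ ω, H ω ∂((P.withDensity f).trim hm) := (lintegral_trim hm hH).symm
    _ ≤ ∫⁻ ω, H ω ∂(P.trim hm) := lintegral_mono' hle le_rfl
    _ = ∫⁻ ω, H ω ∂P := lintegral_trim hm hH

theorem lintegral_mul_exp_finite_range_le (hm : m ≤ mΩ)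
    (hξ : IsCondCenteredSubGaussian P m σ ξ) (hξm : Measurable ξ) {H : Ω → ENNReal}
    (hH : Measurable[m] H) {a : Ω → Fin q → ℝ} (ha : Measurable[m] a)
    (hfin : (Set.range a).Finite) :
    ∫⁻ ω, H ω * ENNReal.ofReal (Real.exp (a ω ⬝ᵥ ξ ω - σ ^ 2 / 2 * (a ω ⬝ᵥ a ω))) ∂P ≤
      ∫⁻ ω, H ω ∂P := by
  classical
  have hs : ∀ u, MeasurableSet[m] (a ⁻¹' {u}) := fun u => ha (measurableSet_singleton u)
  have hHu : ∀ u, Measurable[m] ((a ⁻¹' {u}).indicator H) := fun u => hH.indicator (hs u)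
  have hsplit : ∀ K : Ω → ENNReal, ∀ ω,
      K ω = ∑ u ∈ hfin.toFinset, (a ⁻¹' {u}).indicator K ω := by
    intro K ω
    rw [Finset.sum_eq_single (a ω)]
    · simp
    · intro u _ hu
      exact Set.indicator_of_notMem (fun h => hu (by simpa using h.symm)) _
    · intro h
      exact absurd (hfin.mem_toFinset.mpr ⟨ω, rfl⟩) h
  have hdot : ∀ u : Fin q → ℝ, Measurable fun ω => u ⬝ᵥ ξ ω := fun u => by
    simp only [dotProduct]; fun_prop
  calc ∫⁻ ω, H ω * ENNReal.ofReal (Real.exp (a ω ⬝ᵥ ξ ω - σ ^ 2 / 2 * (a ω ⬝ᵥ a ω))) ∂P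
      = ∫⁻ ω, ∑ u ∈ hfin.toFinset, (a ⁻¹' {u}).indicator H ω *
          ENNReal.ofReal (Real.exp (u ⬝ᵥ ξ ω - σ ^ 2 / 2 * (u ⬝ᵥ u))) ∂P := by
        refine lintegral_congr fun ω => ?_
        rw [hsplit (fun ω => H ω * ENNReal.ofReal
          (Real.exp (a ω ⬝ᵥ ξ ω - σ ^ 2 / 2 * (a ω ⬝ᵥ a ω)))) ω]
        refine Finset.sum_congr rfl fun u _ => ?_
        by_cases h : a ω = u
        · simp [h]
        · simp [h]
    _ = ∑ u ∈ hfin.toFinset, ∫⁻ ω, (a ⁻¹' {u}).indicator H ω *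
          ENNReal.ofReal (Real.exp (u ⬝ᵥ ξ ω - σ ^ 2 / 2 * (u ⬝ᵥ u))) ∂P := by
        refine lintegral_finsetSum _ fun u _ => ?_
        have := (hHu u).mono hm le_rfl
        have := hdot u
        fun_prop
    _ ≤ ∑ u ∈ hfin.toFinset, ∫⁻ ω, (a ⁻¹' {u}).indicator H ω ∂P :=
        Finset.sum_le_sum fun u _ => lintegral_mul_exp_const_le hm hξ hξm (hHu u) u
    _ = ∫⁻ ω, H ω ∂P := by
        rw [← lintegral_finsetSum _ fun u _ => (hHu u).mono hm le_rfl]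
        exact lintegral_congr fun ω => (hsplit H ω).symm

/-- The assumed moment bound concerns each deterministic multiplier separately. It extends to random
`m`-measurable multipliers by simple approximation and Fatou; no boundedness is needed. -/
theorem lintegral_mul_exp_le (hm : m ≤ mΩ)
    (hξ : IsCondCenteredSubGaussian P m σ ξ) (hξm : Measurable ξ) {H : Ω → ENNReal}
    (hH : Measurable[m] H) {a : Ω → Fin q → ℝ} (ha : Measurable[m] a) :
    ∫⁻ ω, H ω * ENNReal.ofReal (Real.exp (a ω ⬝ᵥ ξ ω - σ ^ 2 / 2 * (a ω ⬝ᵥ a ω))) ∂P ≤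
      ∫⁻ ω, H ω ∂P := by
  let b : ℕ → Ω → Fin q → ℝ := fun N =>
    @SimpleFunc.approxOn (Fin q → ℝ) Ω _ _ _ m a ha Set.univ 0 (Set.mem_univ _) _ N
  have hb : ∀ N, Measurable[m] (b N) := fun N => @SimpleFunc.measurable _ _ m _ _
  have hbfin : ∀ N, (Set.range (b N)).Finite := fun N => @SimpleFunc.finite_range _ _ m _
  have hlim : ∀ ω, Filter.Tendsto (fun N => b N ω) Filter.atTop (nhds (a ω)) := fun ω =>
    @SimpleFunc.tendsto_approxOn _ _ _ _ _ m _ ha _ _ (Set.mem_univ _) _ _ (by simp)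
  have hHm : Measurable H := hH.mono hm le_rfl
  have hmeas : ∀ N, Measurable fun ω => H ω *
      ENNReal.ofReal (Real.exp (b N ω ⬝ᵥ ξ ω - σ ^ 2 / 2 * (b N ω ⬝ᵥ b N ω))) := fun N => by
    have := (hb N).mono hm le_rfl
    simp only [dotProduct]
    fun_prop
  calc ∫⁻ ω, H ω * ENNReal.ofReal (Real.exp (a ω ⬝ᵥ ξ ω - σ ^ 2 / 2 * (a ω ⬝ᵥ a ω))) ∂P
      ≤ ∫⁻ ω, Filter.liminf (fun N => H ω * ENNReal.ofReal
          (Real.exp (b N ω ⬝ᵥ ξ ω - σ ^ 2 / 2 * (b N ω ⬝ᵥ b N ω)))) Filter.atTop ∂P := by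
        refine lintegral_mono fun ω => le_of_eq (Filter.Tendsto.liminf_eq ?_).symm
        refine ENNReal.Tendsto.const_mul ?_ (Or.inl (by simp [Real.exp_pos]))
        refine ENNReal.tendsto_ofReal ?_
        have hc : Continuous fun v : Fin q → ℝ =>
            Real.exp (v ⬝ᵥ ξ ω - σ ^ 2 / 2 * (v ⬝ᵥ v)) := by fun_prop
        exact (hc.tendsto _).comp (hlim ω)
    _ ≤ Filter.liminf (fun N => ∫⁻ ω, H ω * ENNReal.ofReal
          (Real.exp (b N ω ⬝ᵥ ξ ω - σ ^ 2 / 2 * (b N ω ⬝ᵥ b N ω))) ∂P) Filter.atTop :=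
        lintegral_liminf_le hmeas
    _ ≤ ∫⁻ ω, H ω ∂P := by
        refine Filter.liminf_le_of_frequently_le' (Filter.Frequently.of_forall fun N => ?_)
        exact lintegral_mul_exp_finite_range_le hm hξ hξm hH (hb N) (hbfin N)

/-- The exponential supermartingale of the noise with predictable multipliers `a t`. -/
theorem lintegral_exp_sum_le_one {F : Filtration ℕ mΩ} {n : ℕ} {η a : ℕ → Ω → Fin q → ℝ}
    (hη : ∀ t ∈ Finset.Icc 1 n, IsCondCenteredSubGaussian P (F t) σ (η t))
    (hηm : ∀ t, Measurable (η t)) (hηF : ∀ t ≥ 1, Measurable[F (t + 1)] (η t))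
    (ha : ∀ t ∈ Finset.Icc 1 n, Measurable[F t] (a t)) :
    ∫⁻ ω, ENNReal.ofReal (Real.exp (∑ t ∈ Finset.Icc 1 n,
      (a t ω ⬝ᵥ η t ω - σ ^ 2 / 2 * (a t ω ⬝ᵥ a t ω)))) ∂P ≤ 1 := by
  induction n with
  | zero => simp
  | succ n ih =>
    specialize ih (fun t ht => hη t (Finset.Icc_subset_Icc le_rfl n.le_succ ht))
      (fun t ht => ha t (Finset.Icc_subset_Icc le_rfl n.le_succ ht))
    have hmem : n + 1 ∈ Finset.Icc 1 (n + 1) := by simp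
    refine le_trans (le_of_eq ?_) ((lintegral_mul_exp_le (F.le (n + 1)) (hη _ hmem) (hηm _)
      (H := fun ω => ENNReal.ofReal (Real.exp (∑ t ∈ Finset.Icc 1 n,
        (a t ω ⬝ᵥ η t ω - σ ^ 2 / 2 * (a t ω ⬝ᵥ a t ω))))) ?_ (ha _ hmem)).trans ih)
    · refine lintegral_congr fun ω => ?_
      rw [← ENNReal.ofReal_mul (Real.exp_pos _).le, ← Real.exp_add,
        Finset.sum_Icc_succ_top (by omega)]
    · refine ENNReal.measurable_ofReal.comp (Real.measurable_exp.comp ?_)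
      refine Finset.measurable_sum _ fun t ht => ?_
      rw [Finset.mem_Icc] at ht
      have h1 : Measurable[F (n + 1)] (η t) :=
        (hηF t ht.1).mono (F.mono (by omega)) le_rfl
      have h2 : Measurable[F (n + 1)] (a t) :=
        (ha t (Finset.mem_Icc.mpr ⟨ht.1, by omega⟩)).mono (F.mono (by omega)) le_rfl
      simp only [dotProduct]
      have h1' := fun i => (measurable_pi_apply i).comp h1
      have h2' := fun i => (measurable_pi_apply i).comp h2
      refine Measurable.sub ?_ (Measurable.const_mul ?_ _)
      · exact Finset.measurable_sum _ fun i _ => (h2' i).mul (h1' i)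
      · exact Finset.measurable_sum _ fun i _ => (h2' i).mul (h2' i)

end SelfNormalized

/-! ### Bounds uniform in the direction -/

section Uniform

variable {Ω : Type*} [mΩ : MeasurableSpace Ω] {P : Measure Ω} [SFinite P] {m : ℕ}
  {S : Ω → Fin m → ℝ} {G : Ω → Matrix (Fin m) (Fin m) ℝ} {V W A B : Matrix (Fin m) (Fin m) ℝ}

theorem measurable_quadratic (hG : ∀ i j, Measurable fun ω => G ω i j) :
    Measurable fun p : Ω × (Fin m → ℝ) => p.2 ⬝ᵥ G p.1 *ᵥ p.2 := by
  have h : ∀ i j, Measurable fun p : Ω × (Fin m → ℝ) => G p.1 i j := fun i j =>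
    (hG i j).comp measurable_fst
  simp only [dotProduct, mulVec]
  fun_prop

/-- The exponent of the Gaussian mixture, re-centred at its maximizer `σ⁻² M⁻¹ s`. -/
theorem complete_square {M : Matrix (Fin m) (Fin m) ℝ} (hM : M.PosDef) (s x : Fin m → ℝ) {σ : ℝ}
    (hσ : σ ≠ 0) :
    (x + (σ ^ 2)⁻¹ • (M⁻¹ *ᵥ s)) ⬝ᵥ s - σ ^ 2 / 2 * ((x + (σ ^ 2)⁻¹ • (M⁻¹ *ᵥ s)) ⬝ᵥ
      M *ᵥ (x + (σ ^ 2)⁻¹ • (M⁻¹ *ᵥ s))) =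
    (M⁻¹ *ᵥ s) ⬝ᵥ s / (2 * σ ^ 2) + -(σ ^ 2 / 2) * (x ⬝ᵥ M *ᵥ x) := by
  have hs : M *ᵥ (M⁻¹ *ᵥ s) = s := by
    rw [mulVec_mulVec, mul_nonsing_inv _ hM.det_pos.ne'.isUnit, one_mulVec]
  rw [dotProduct_mulVec_add hM.isHermitian, hs, add_dotProduct, smul_dotProduct, smul_eq_mul]
  field_simp
  ring

theorem two_mul_dotProduct_sub_le {M : Matrix (Fin m) (Fin m) ℝ} (hM : M.PosDef)
    (s w : Fin m → ℝ) : 2 * (w ⬝ᵥ s) - w ⬝ᵥ M *ᵥ w ≤ (M⁻¹ *ᵥ s) ⬝ᵥ s := by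
  have hs : M *ᵥ (M⁻¹ *ᵥ s) = s := by
    rw [mulVec_mulVec, mul_nonsing_inv _ hM.det_pos.ne'.isUnit, one_mulVec]
  have h := hM.posSemidef.dotProduct_mulVec_nonneg (w + (-1 : ℝ) • (M⁻¹ *ᵥ s))
  rw [star_trivial, dotProduct_mulVec_add hM.isHermitian, hs] at h
  linarith

/-- Method of mixtures: the exponential inequality is averaged over `v` with the Gaussian weight
`exp (-σ² vᵀ V v / 2)`. As long as `G + V ≤ W`, the mixture is at least the Gaussian integral of `W`
times the exponential of the maximum of the quadratic, so Markov's inequality bounds that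
maximum. -/
theorem measure_selfNormalized_le_of_pos (hS : Measurable S)
    (hGm : ∀ i j, Measurable fun ω => G ω i j) (hG : ∀ ω, (G ω).PosSemidef)
    (hV : V.PosDef) (hW : W.PosDef) {σ δ : ℝ} (hσ : 0 < σ) (hδ : 0 < δ)
    (hexp : ∀ v : Fin m → ℝ, ∫⁻ ω, ENNReal.ofReal
      (Real.exp (v ⬝ᵥ S ω - σ ^ 2 / 2 * (v ⬝ᵥ G ω *ᵥ v))) ∂P ≤ 1) :
    P {ω | (W - (G ω + V)).PosSemidef ∧ ∃ w : Fin m → ℝ,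
      σ ^ 2 * (2 * Real.log (1 / δ) + Real.log (W * V⁻¹).det) <
        2 * (w ⬝ᵥ S ω) - w ⬝ᵥ (G ω + V) *ᵥ w} ≤ ENNReal.ofReal δ := by
  set J : Matrix (Fin m) (Fin m) ℝ → ENNReal := fun M =>
    ∫⁻ x : Fin m → ℝ, ENNReal.ofReal (Real.exp (-(σ ^ 2 / 2) * (x ⬝ᵥ M *ᵥ x))) with hJ
  have hσ2 : 0 < σ ^ 2 / 2 := by positivity
  have hJV0 : J V ≠ 0 := lintegral_gaussian_pos.ne'
  have hJVt : J V ≠ ⊤ := (lintegral_gaussian_lt_top hV hσ2).ne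
  have hD : 0 < (W * V⁻¹).det := by
    rw [det_mul, det_nonsing_inv, Ring.inverse_eq_inv']
    exact mul_pos hW.det_pos (inv_pos.mpr hV.det_pos)
  have hJW : J W = ENNReal.ofReal (√(W * V⁻¹).det)⁻¹ * J V :=
    lintegral_comp_quadratic hV hW (g := fun y => ENNReal.ofReal (Real.exp (-(σ ^ 2 / 2) * y)))
      (by fun_prop)
  set f : Ω → (Fin m → ℝ) → ENNReal := fun ω v => ENNReal.ofReal
    (Real.exp (v ⬝ᵥ S ω - σ ^ 2 / 2 * (v ⬝ᵥ G ω *ᵥ v))) *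
      ENNReal.ofReal (Real.exp (-(σ ^ 2 / 2) * (v ⬝ᵥ V *ᵥ v))) with hf
  have hfm : Measurable (Function.uncurry f) := by
    have h1 := measurable_quadratic hGm
    have h2 : Measurable fun p : Ω × (Fin m → ℝ) => p.2 ⬝ᵥ S p.1 := by
      simp only [dotProduct]; fun_prop
    have h3 : Measurable fun p : Ω × (Fin m → ℝ) => p.2 ⬝ᵥ V *ᵥ p.2 :=
      (continuous_dotProduct_mulVec V).measurable.comp measurable_snd
    simp only [Function.uncurry_def, hf]
    fun_prop
  have hmean : ∫⁻ ω, (∫⁻ v, f ω v) ∂P ≤ J V := by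
    rw [lintegral_lintegral_swap hfm.aemeasurable]
    refine lintegral_mono fun v => ?_
    have hvm : Measurable fun ω => ENNReal.ofReal
        (Real.exp (v ⬝ᵥ S ω - σ ^ 2 / 2 * (v ⬝ᵥ G ω *ᵥ v))) := by
      have h1 : Measurable fun ω => v ⬝ᵥ G ω *ᵥ v :=
        (measurable_quadratic hGm).comp (measurable_id.prodMk measurable_const)
      have h2 : Measurable fun ω => v ⬝ᵥ S ω := by simp only [dotProduct]; fun_prop
      fun_prop
    simp only [hf]
    rw [lintegral_mul_const _ hvm]
    exact mul_le_of_le_one_left' (hexp v)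
  have hlow : {ω | (W - (G ω + V)).PosSemidef ∧ ∃ w : Fin m → ℝ,
      σ ^ 2 * (2 * Real.log (1 / δ) + Real.log (W * V⁻¹).det) <
        2 * (w ⬝ᵥ S ω) - w ⬝ᵥ (G ω + V) *ᵥ w} ⊆
      {ω | ENNReal.ofReal δ⁻¹ * J V ≤ ∫⁻ v, f ω v} := by
    rintro ω ⟨hWG, w, hw⟩
    have hM : (G ω + V).PosDef := PosDef.posSemidef_add (hG ω) hV
    set M := G ω + V with hMdef
    set v₀ := (σ ^ 2)⁻¹ • (M⁻¹ *ᵥ S ω) with hv₀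
    have hfe : ∀ v, f ω v =
        ENNReal.ofReal (Real.exp (v ⬝ᵥ S ω - σ ^ 2 / 2 * (v ⬝ᵥ M *ᵥ v))) := fun v => by
      simp only [hf]
      rw [← ENNReal.ofReal_mul (Real.exp_pos _).le, ← Real.exp_add, hMdef, add_mulVec,
        dotProduct_add]
      congr 2; ring
    have hq : Real.log (δ⁻¹ * √(W * V⁻¹).det) ≤ (M⁻¹ *ᵥ S ω) ⬝ᵥ S ω / (2 * σ ^ 2) := by
      rw [Real.log_mul (inv_pos.mpr hδ).ne' (Real.sqrt_pos.mpr hD).ne',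
        Real.log_sqrt hD.le, le_div_iff₀ (by positivity)]
      have := (hw.le).trans (two_mul_dotProduct_sub_le hM (S ω) w)
      rw [one_div] at this
      linarith
    have hpos : 0 < δ⁻¹ * √(W * V⁻¹).det := by positivity
    simp only [Set.mem_ofPred_eq]
    calc ENNReal.ofReal δ⁻¹ * J V
        = ENNReal.ofReal (δ⁻¹ * √(W * V⁻¹).det) * J W := by
          rw [hJW, ← mul_assoc, ← ENNReal.ofReal_mul hpos.le]
          congr 2
          field_simp
      _ ≤ ENNReal.ofReal (Real.exp ((M⁻¹ *ᵥ S ω) ⬝ᵥ S ω / (2 * σ ^ 2))) * J W := by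
          gcongr
          exact (Real.log_le_iff_le_exp hpos).mp hq
      _ ≤ ENNReal.ofReal (Real.exp ((M⁻¹ *ᵥ S ω) ⬝ᵥ S ω / (2 * σ ^ 2))) * J M := by
          refine mul_le_mul_right (lintegral_mono fun x => ?_) _
          gcongr ENNReal.ofReal (Real.exp ?_)
          have := hWG.dotProduct_mulVec_nonneg x
          rw [star_trivial, sub_mulVec, dotProduct_sub] at this
          nlinarith
      _ = ∫⁻ v, f ω v := by
          rw [← lintegral_const_mul _ (by
            have := (continuous_dotProduct_mulVec M).measurable
            fun_prop), ← lintegral_add_right_eq_self (f ω) v₀]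
          refine lintegral_congr fun x => ?_
          rw [hfe, complete_square hM _ _ hσ.ne', Real.exp_add,
            ENNReal.ofReal_mul (Real.exp_pos _).le]
  have hmk := (mul_meas_ge_le_lintegral hfm.lintegral_prod_right
    (ENNReal.ofReal δ⁻¹ * J V)).trans hmean
  refine (measure_mono hlow).trans ?_
  rw [mul_assoc, mul_left_comm] at hmk
  have h1 := (ENNReal.mul_le_mul_iff_right hJV0 hJVt).mp (hmk.trans (mul_one _).ge)
  rw [ENNReal.ofReal_inv_of_pos hδ, mul_comm, ← div_eq_mul_inv,
    ← ENNReal.ofReal_inv_of_pos hδ] at h1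
  exact ENNReal.div_le_iff' (by simpa using hδ) (by simp) |>.mp h1 |>.trans (mul_one _).le

/-- The case `σ = 0` is included by letting the variance proxy decrease to `σ`: the exceptional sets
increase to the one at `σ`. -/
theorem measure_selfNormalized_le (hS : Measurable S)
    (hGm : ∀ i j, Measurable fun ω => G ω i j) (hG : ∀ ω, (G ω).PosSemidef)
    (hV : V.PosDef) (hW : W.PosDef) (hVW : (W - V).PosSemidef) {σ δ : ℝ} (hσ : 0 ≤ σ)
    (hδ : 0 < δ) (hδ1 : δ ≤ 1)
    (hexp : ∀ v : Fin m → ℝ, ∫⁻ ω, ENNReal.ofReal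
      (Real.exp (v ⬝ᵥ S ω - σ ^ 2 / 2 * (v ⬝ᵥ G ω *ᵥ v))) ∂P ≤ 1) :
    P {ω | (W - (G ω + V)).PosSemidef ∧ ∃ w : Fin m → ℝ,
      σ ^ 2 * (2 * Real.log (1 / δ) + Real.log (W * V⁻¹).det) <
        2 * (w ⬝ᵥ S ω) - w ⬝ᵥ (G ω + V) *ᵥ w} ≤ ENNReal.ofReal δ := by
  set K := 2 * Real.log (1 / δ) + Real.log (W * V⁻¹).det with hK
  have hK0 : 0 ≤ K := by
    have h1 := Real.log_nonneg (one_le_det_mul_inv hV hW hVW)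
    have h2 := Real.log_nonneg (one_le_one_div hδ hδ1)
    linarith
  set s : ℕ → ℝ := fun j => σ + 1 / ((j : ℝ) + 1) with hs
  have hs0 : ∀ j, σ < s j := fun j => by
    simp only [hs]
    linarith [Nat.one_div_pos_of_nat (α := ℝ) (n := j)]
  have hanti : Antitone s := fun i j hij => by
    simp only [hs]
    gcongr
  set bad : ℝ → Set Ω := fun τ => {ω | (W - (G ω + V)).PosSemidef ∧ ∃ w : Fin m → ℝ,
      τ ^ 2 * K < 2 * (w ⬝ᵥ S ω) - w ⬝ᵥ (G ω + V) *ᵥ w} with hbad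
  have hsub : bad σ ⊆ ⋃ j, bad (s j) := by
    rintro ω ⟨h1, w, hw⟩
    have hlim : Filter.Tendsto (fun j => s j ^ 2 * K) Filter.atTop (nhds (σ ^ 2 * K)) := by
      have : Filter.Tendsto s Filter.atTop (nhds (σ + 0)) :=
        tendsto_const_nhds.add tendsto_one_div_add_atTop_nhds_zero_nat
      rw [add_zero] at this
      exact (this.pow 2).mul_const K
    obtain ⟨j, hj⟩ := (hlim.eventually_lt_const hw).exists
    exact Set.mem_iUnion.mpr ⟨j, h1, w, hj⟩
  have hmono : Monotone fun j => bad (s j) := by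
    rintro i j hij ω ⟨h1, w, hw⟩
    refine ⟨h1, w, lt_of_le_of_lt ?_ hw⟩
    have := hanti hij
    have := (hσ.trans_lt (hs0 j)).le
    gcongr
  refine (measure_mono hsub).trans ?_
  rw [hmono.directed_le.measure_iUnion]
  refine iSup_le fun j => measure_selfNormalized_le_of_pos hS hGm hG hV hW
    (hσ.trans_lt (hs0 j)) hδ fun v => le_trans (lintegral_mono fun ω => ?_) (hexp v)
  have h1 : 0 ≤ v ⬝ᵥ G ω *ᵥ v := by simpa using (hG ω).dotProduct_mulVec_nonneg v
  have := (hs0 j).le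
  gcongr

open scoped MatrixOrder in
theorem exists_euclNorm_sq_eq {M : Matrix (Fin m) (Fin m) ℝ} (hM : M.PosSemidef) :
    ∃ C : Matrix (Fin m) (Fin m) ℝ, ∀ x, x ⬝ᵥ M *ᵥ x = euclNorm (C *ᵥ x) ^ 2 := by
  obtain ⟨C, hC⟩ := CStarAlgebra.nonneg_iff_eq_star_mul_self.mp hM.nonneg
  refine ⟨C, fun x => ?_⟩
  rw [hC, star_eq_conjTranspose, conjTranspose_eq_transpose_of_trivial, ← mulVec_mulVec,
    dotProduct_mulVec, vecMul_transpose, dotProduct_self_eq]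

theorem sqrt_quadratic_add_le {M : Matrix (Fin m) (Fin m) ℝ} (hM : M.PosSemidef)
    (x y : Fin m → ℝ) : √((x + y) ⬝ᵥ M *ᵥ (x + y)) ≤ √(x ⬝ᵥ M *ᵥ x) + √(y ⬝ᵥ M *ᵥ y) := by
  obtain ⟨C, hC⟩ := exists_euclNorm_sq_eq hM
  have h0 : ∀ z : Fin m → ℝ, 0 ≤ euclNorm z := fun z => norm_nonneg _
  rw [hC, hC, hC, Real.sqrt_sq (h0 _), Real.sqrt_sq (h0 _), Real.sqrt_sq (h0 _), mulVec_add]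
  exact norm_add_le (WithLp.toLp 2 (C *ᵥ x)) (WithLp.toLp 2 (C *ᵥ y))

theorem volume_quadratic_le {M : Matrix (Fin m) (Fin m) ℝ} {r : ℝ} (hr : 0 < r)
    (v : Fin m → ℝ) : volume {u : Fin m → ℝ | (u - v) ⬝ᵥ M *ᵥ (u - v) ≤ r ^ 2} =
      ENNReal.ofReal (r ^ m) * volume {x : Fin m → ℝ | x ⬝ᵥ M *ᵥ x ≤ 1} := by
  have h1 : {u : Fin m → ℝ | (u - v) ⬝ᵥ M *ᵥ (u - v) ≤ r ^ 2} =
      (fun u => u - v) ⁻¹' ((fun x => r⁻¹ • x) ⁻¹' {x : Fin m → ℝ | x ⬝ᵥ M *ᵥ x ≤ 1}) := by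
    ext u
    simp only [Set.mem_ofPred_eq, Set.mem_preimage, mulVec_smul, dotProduct_smul, smul_dotProduct,
      smul_eq_mul]
    rw [← mul_assoc, ← sq, inv_pow, inv_mul_le_iff₀ (by positivity), mul_one]
  rw [h1]
  simp only [sub_eq_add_neg]
  rw [measure_preimage_add_right, Measure.addHaar_preimage_smul volume (inv_pos.mpr hr).ne']
  simp only [Module.finrank_fintype_fun_eq_card, Fintype.card_fin]
  rw [inv_pow, inv_inv, abs_of_pos (by positivity)]

/-- Uniformity over directions without a net. If a unit vector `v` of the `A` geometry has
`vᵀ G v < c N`, then every vector of the `B`-ellipsoid of radius `ε` around `v` violates the fixed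
direction bound with constant `κ`. The set of violating vectors thus has volume bounded below, while
its expected volume is at most `p` times the volume of the `A`-ball of radius `1 + ε`. -/
theorem measure_not_lower_le (hGm : ∀ i j, Measurable fun ω => G ω i j)
    (hG : ∀ ω, (G ω).PosSemidef) (hA : A.PosDef) (hB : B.PosDef) (hAB : (B - A).PosSemidef)
    {N c ε κ p : ℝ} (hN : 0 ≤ N) (hc : 0 ≤ c) (hε : 0 < ε) (hε1 : ε < 1) (hκ : 0 ≤ κ)
    (hcκ : (√c + ε) ^ 2 * N ≤ κ * (1 - ε) ^ 2)
    (hp : ∀ u : Fin m → ℝ, u ≠ 0 →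
      P {ω | u ⬝ᵥ G ω *ᵥ u ≤ κ * (u ⬝ᵥ A *ᵥ u)} ≤ ENNReal.ofReal p) :
    P {ω | (N • B - G ω).PosSemidef ∧ ¬ (G ω - (c * N) • A).PosSemidef} ≤
      ENNReal.ofReal (p * (((1 + ε) / ε) ^ m * √(B * A⁻¹).det)) := by
  set vA := volume {x : Fin m → ℝ | x ⬝ᵥ A *ᵥ x ≤ 1} with hvA
  have hvA0 : vA ≠ 0 := volume_ellipsoid_pos.ne'
  have hvAt : vA ≠ ⊤ := (volume_ellipsoid_lt_top hA).ne
  have hdet : 0 < √(B * A⁻¹).det :=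
    Real.sqrt_pos.mpr (zero_lt_one.trans_le (one_le_det_mul_inv hA hB hAB))
  set D : Set (Ω × (Fin m → ℝ)) := {z | z.2 ≠ 0 ∧ z.2 ⬝ᵥ A *ᵥ z.2 ≤ (1 + ε) ^ 2 ∧
    z.2 ⬝ᵥ G z.1 *ᵥ z.2 ≤ κ * (z.2 ⬝ᵥ A *ᵥ z.2)} with hD
  have hqA : Measurable fun z : Ω × (Fin m → ℝ) => z.2 ⬝ᵥ A *ᵥ z.2 :=
    (continuous_dotProduct_mulVec A).measurable.comp measurable_snd
  have hDm : MeasurableSet D := by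
    refine MeasurableSet.inter ?_ (MeasurableSet.inter ?_ ?_)
    · exact (measurable_snd (measurableSet_singleton 0)).compl
    · exact measurableSet_le hqA measurable_const
    · exact measurableSet_le (measurable_quadratic hGm) (hqA.const_mul κ)
  have hmean : ∫⁻ ω, volume (Prod.mk ω ⁻¹' D) ∂P ≤
      ENNReal.ofReal p * (ENNReal.ofReal ((1 + ε) ^ m) * vA) := by
    rw [← Measure.prod_apply hDm, Measure.prod_apply_symm hDm]
    have hKm : MeasurableSet {u : Fin m → ℝ | u ⬝ᵥ A *ᵥ u ≤ (1 + ε) ^ 2} :=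
      measurableSet_le (continuous_dotProduct_mulVec A).measurable measurable_const
    have hK := volume_quadratic_le (M := A) (r := 1 + ε) (by linarith) 0
    simp only [sub_zero] at hK
    rw [hvA, ← hK, ← lintegral_indicator_const hKm]
    refine lintegral_mono fun u => ?_
    by_cases h : u ≠ 0 ∧ u ⬝ᵥ A *ᵥ u ≤ (1 + ε) ^ 2
    · rw [Set.indicator_of_mem (by exact h.2)]
      exact (measure_mono fun ω hω => hω.2.2).trans (hp u h.1)
    · have : (fun ω => (ω, u)) ⁻¹' D = ∅ := by
        ext ω
        simp only [Set.mem_preimage, Set.mem_empty_iff_false, iff_false]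
        exact fun hω => h ⟨hω.1, hω.2.1⟩
      rw [this]
      simp
  have hlow : {ω | (N • B - G ω).PosSemidef ∧ ¬ (G ω - (c * N) • A).PosSemidef} ⊆
      {ω | ENNReal.ofReal (ε ^ m * (√(B * A⁻¹).det)⁻¹) * vA ≤ volume (Prod.mk ω ⁻¹' D)} := by
    rintro ω ⟨hup, hnot⟩
    have hex : ∃ v : Fin m → ℝ, v ⬝ᵥ G ω *ᵥ v < c * N * (v ⬝ᵥ A *ᵥ v) := by
      by_contra! h
      refine hnot (PosSemidef.of_dotProduct_mulVec_nonneg ?_ fun x => ?_)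
      · refine (hG ω).isHermitian.sub ?_
        rw [IsHermitian, conjTranspose_smul, hA.isHermitian.eq, star_trivial]
      · rw [star_trivial, sub_mulVec, smul_mulVec, dotProduct_sub, dotProduct_smul, smul_eq_mul]
        linarith [h x]
    obtain ⟨v', hv'⟩ := hex
    have hG0 : ∀ x : Fin m → ℝ, 0 ≤ x ⬝ᵥ G ω *ᵥ x := fun x => by
      simpa using (hG ω).dotProduct_mulVec_nonneg x
    have hA0 : 0 < v' ⬝ᵥ A *ᵥ v' := by
      by_contra! h
      have := hG0 v'
      have := mul_nonpos_of_nonneg_of_nonpos (mul_nonneg hc hN) h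
      linarith
    obtain ⟨v, hvA1, hvG⟩ : ∃ v : Fin m → ℝ, v ⬝ᵥ A *ᵥ v = 1 ∧ v ⬝ᵥ G ω *ᵥ v ≤ c * N := by
      refine ⟨(√(v' ⬝ᵥ A *ᵥ v'))⁻¹ • v', ?_, ?_⟩
      · simp only [mulVec_smul, dotProduct_smul, smul_dotProduct, smul_eq_mul]
        rw [← mul_assoc, ← sq, inv_pow, Real.sq_sqrt hA0.le, inv_mul_cancel₀ hA0.ne']
      · simp only [mulVec_smul, dotProduct_smul, smul_dotProduct, smul_eq_mul]
        rw [← mul_assoc, ← sq, inv_pow, Real.sq_sqrt hA0.le, inv_mul_le_iff₀ hA0]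
        linarith
    -- The `B`-ellipsoid of radius `ε` around `v` consists of violating vectors.
    have hvol : ENNReal.ofReal (ε ^ m * (√(B * A⁻¹).det)⁻¹) * vA =
        volume {u : Fin m → ℝ | (u - v) ⬝ᵥ B *ᵥ (u - v) ≤ ε ^ 2} := by
      rw [volume_quadratic_le hε, volume_ellipsoid_eq hA hB, ← mul_assoc,
        ENNReal.ofReal_mul (by positivity)]
    simp only [Set.mem_ofPred_eq]
    rw [hvol]
    refine measure_mono fun u hu => ?_
    simp only [Set.mem_ofPred_eq] at hu
    set x := u - v with hx
    have hux : u = v + x := by rw [hx]; abel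
    have hxA : x ⬝ᵥ A *ᵥ x ≤ ε ^ 2 := by
      have := hAB.dotProduct_mulVec_nonneg x
      rw [star_trivial, sub_mulVec, dotProduct_sub] at this
      linarith
    have hxG : x ⬝ᵥ G ω *ᵥ x ≤ N * ε ^ 2 := by
      have := hup.dotProduct_mulVec_nonneg x
      rw [star_trivial, sub_mulVec, smul_mulVec, dotProduct_sub, dotProduct_smul,
        smul_eq_mul] at this
      have := mul_le_mul_of_nonneg_left hu hN
      linarith
    have hsA : √(x ⬝ᵥ A *ᵥ x) ≤ ε := Real.sqrt_le_iff.mpr ⟨hε.le, hxA⟩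
    have hAu1 : √(u ⬝ᵥ A *ᵥ u) ≤ 1 + ε := by
      have := sqrt_quadratic_add_le hA.posSemidef v x
      rw [← hux, hvA1, Real.sqrt_one] at this
      linarith
    have hAu2 : 1 - ε ≤ √(u ⬝ᵥ A *ᵥ u) := by
      have h := sqrt_quadratic_add_le hA.posSemidef u (-x)
      have e : u + -x = v := by rw [hux]; abel
      rw [e, hvA1, Real.sqrt_one, mulVec_neg, dotProduct_neg, neg_dotProduct, neg_neg] at h
      linarith
    have hGu : √(u ⬝ᵥ G ω *ᵥ u) ≤ (√c + ε) * √N := by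
      have h := sqrt_quadratic_add_le (hG ω) v x
      rw [← hux] at h
      have h1 := Real.sqrt_le_sqrt hvG
      have h2 := Real.sqrt_le_sqrt hxG
      rw [Real.sqrt_mul hc] at h1
      rw [Real.sqrt_mul hN, Real.sqrt_sq hε.le] at h2
      linarith
    have hApos : 0 < √(u ⬝ᵥ A *ᵥ u) := by linarith
    have hAsq := Real.sq_sqrt (Real.sqrt_pos.mp hApos).le
    refine ⟨?_, ?_, ?_⟩
    · show u ≠ 0
      rintro rfl
      simp at hApos
    · show u ⬝ᵥ A *ᵥ u ≤ (1 + ε) ^ 2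
      rw [← hAsq]; gcongr
    · show u ⬝ᵥ G ω *ᵥ u ≤ κ * (u ⬝ᵥ A *ᵥ u)
      calc u ⬝ᵥ G ω *ᵥ u = √(u ⬝ᵥ G ω *ᵥ u) ^ 2 := (Real.sq_sqrt (hG0 u)).symm
        _ ≤ ((√c + ε) * √N) ^ 2 := by gcongr
        _ = (√c + ε) ^ 2 * N := by rw [mul_pow, Real.sq_sqrt hN]
        _ ≤ κ * (1 - ε) ^ 2 := hcκ
        _ ≤ κ * √(u ⬝ᵥ A *ᵥ u) ^ 2 := by
          have : 0 ≤ 1 - ε := by linarith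
          gcongr
        _ = κ * (u ⬝ᵥ A *ᵥ u) := by rw [hAsq]
  have hmk := (mul_meas_ge_le_lintegral (measurable_measure_prodMk_left hDm)
    (ENNReal.ofReal (ε ^ m * (√(B * A⁻¹).det)⁻¹) * vA)).trans hmean
  refine (measure_mono hlow).trans ?_
  set Q := P {ω | ENNReal.ofReal (ε ^ m * (√(B * A⁻¹).det)⁻¹) * vA ≤ volume (Prod.mk ω ⁻¹' D)}
  have hb : 0 < ε ^ m * (√(B * A⁻¹).det)⁻¹ := by positivity
  have h1 : vA * (ENNReal.ofReal (ε ^ m * (√(B * A⁻¹).det)⁻¹) * Q) ≤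
      vA * (ENNReal.ofReal p * ENNReal.ofReal ((1 + ε) ^ m)) := by
    calc _ = ENNReal.ofReal (ε ^ m * (√(B * A⁻¹).det)⁻¹) * vA * Q := by ring
      _ ≤ _ := hmk
      _ = _ := by ring
  have h2 := (ENNReal.mul_le_mul_iff_right hvA0 hvAt).mp h1
  rw [← ENNReal.ofReal_mul' (by positivity), mul_comm] at h2
  rw [← ENNReal.le_div_iff_mul_le (Or.inl (by simpa using hb)) (Or.inl (by simp)),
    ← ENNReal.ofReal_div_of_pos hb] at h2
  refine h2.trans (le_of_eq ?_)
  congr 1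
  rw [div_pow]
  field_simp

end Uniform

/-! ### Algebra of restricted least squares -/

section Algebra

variable {n q d m : ℕ}

/-- The coefficient matrix, of size `q × d`, whose rows are stacked in the vector `b`. -/
def rowsOf (b : Fin q × Fin d → ℝ) (i : Fin q) (j : Fin d) : ℝ := b (i, j)

theorem one_kronecker_mulVec {l : Type*} (A : Matrix l (Fin d) ℝ) (b : Fin q × Fin d → ℝ)
    (p : Fin q × l) :
    (((1 : Matrix (Fin q) (Fin q) ℝ) ⊗ₖ A) *ᵥ b) p = (A *ᵥ rowsOf b p.1) p.2 := by
  obtain ⟨i, t⟩ := p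
  simp only [mulVec, dotProduct, kroneckerMap_apply, Fintype.sum_prod_type, rowsOf]
  rw [Finset.sum_eq_single i]
  · simp
  · intro b _ hb
    simp [one_apply_ne hb.symm]
  · simp

theorem designMatrix_mulVec (X : Matrix (Fin n) (Fin d) ℝ)
    (R : Matrix (Fin q × Fin d) (Fin m) ℝ) (v : Fin m → ℝ) (p : Fin q × Fin n) :
    (designMatrix X R *ᵥ v) p = X p.2 ⬝ᵥ rowsOf (R *ᵥ v) p.1 := by
  rw [designMatrix, ← mulVec_mulVec, one_kronecker_mulVec]; rfl

theorem restrictedGram_quadratic (Γ : Matrix (Fin d) (Fin d) ℝ)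
    (R : Matrix (Fin q × Fin d) (Fin m) ℝ) (v : Fin m → ℝ) :
    v ⬝ᵥ restrictedGram Γ R *ᵥ v =
      ∑ i, rowsOf (R *ᵥ v) i ⬝ᵥ Γ *ᵥ rowsOf (R *ᵥ v) i := by
  rw [restrictedGram, ← mulVec_mulVec, ← mulVec_mulVec, dotProduct_mulVec, vecMul_transpose,
    dotProduct, Fintype.sum_prod_type]
  refine Finset.sum_congr rfl fun i _ => ?_
  simp only [one_kronecker_mulVec]
  rfl

theorem restrictedGram_posDef {Γ : Matrix (Fin d) (Fin d) ℝ}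
    {R : Matrix (Fin q × Fin d) (Fin m) ℝ} (hΓ : Γ.PosDef) (hR : Function.Injective R.mulVec) :
    (restrictedGram Γ R).PosDef := by
  have h := ((PosDef.one (n := Fin q) (R := ℝ)).kronecker hΓ).conjTranspose_mul_mul_same hR
  rwa [conjTranspose_eq_transpose_of_trivial] at h

theorem restrictedGram_sub (Γ Γ' : Matrix (Fin d) (Fin d) ℝ)
    (R : Matrix (Fin q × Fin d) (Fin m) ℝ) :
    restrictedGram Γ R - restrictedGram Γ' R = restrictedGram (Γ - Γ') R := by
  have h : (1 : Matrix (Fin q) (Fin q) ℝ) ⊗ₖ (Γ - Γ') = 1 ⊗ₖ Γ - 1 ⊗ₖ Γ' := by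
    ext p r; simp [kroneckerMap_apply, mul_sub]
  rw [restrictedGram, restrictedGram, restrictedGram, h, Matrix.mul_sub, Matrix.sub_mul]

theorem restrictedGram_posSemidef {Γ : Matrix (Fin d) (Fin d) ℝ}
    (R : Matrix (Fin q × Fin d) (Fin m) ℝ) (hΓ : Γ.PosSemidef) :
    (restrictedGram Γ R).PosSemidef := by
  have h := ((PosSemidef.one (n := Fin q) (R := ℝ)).kronecker hΓ).conjTranspose_mul_mul_same R
  rwa [conjTranspose_eq_transpose_of_trivial] at h

theorem IsRestriction.mul_eq_one {C : Matrix (Fin (q * d - m)) (Fin q × Fin d) ℝ}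
    {Cplus : Matrix (Fin m) (Fin q × Fin d) ℝ} {R : Matrix (Fin q × Fin d) (Fin m) ℝ}
    {Rplus : Matrix (Fin q × Fin d) (Fin (q * d - m)) ℝ} (h : IsRestriction C Cplus R Rplus) :
    Cplus * R = 1 := by
  have := h.full_mul_inv
  rw [fromRows_mul_fromCols, ← fromBlocks_one, fromBlocks_inj] at this
  exact this.1

theorem IsRestriction.mulVec_add_eq {C : Matrix (Fin (q * d - m)) (Fin q × Fin d) ℝ}
    {Cplus : Matrix (Fin m) (Fin q × Fin d) ℝ} {R : Matrix (Fin q × Fin d) (Fin m) ℝ}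
    {Rplus : Matrix (Fin q × Fin d) (Fin (q * d - m)) ℝ} (h : IsRestriction C Cplus R Rplus)
    (b : Fin q × Fin d → ℝ) : R *ᵥ (Cplus *ᵥ b) + Rplus *ᵥ (C *ᵥ b) = b := by
  have := h.inv_mul_full
  rw [fromCols_mul_fromRows] at this
  rw [mulVec_mulVec, mulVec_mulVec, ← add_mulVec, this, one_mulVec]

theorem IsRestriction.injective {C : Matrix (Fin (q * d - m)) (Fin q × Fin d) ℝ}
    {Cplus : Matrix (Fin m) (Fin q × Fin d) ℝ} {R : Matrix (Fin q × Fin d) (Fin m) ℝ}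
    {Rplus : Matrix (Fin q × Fin d) (Fin (q * d - m)) ℝ} (h : IsRestriction C Cplus R Rplus) :
    Function.Injective R.mulVec := fun x y hxy => by
  have := congrArg (Cplus *ᵥ ·) hxy
  simpa [mulVec_mulVec, h.mul_eq_one] using this

/-- Optimality along the line through the origin and the fitted value `z`. -/
theorem dotProduct_eq_of_forall_euclNorm_le {ι : Type*} [Fintype ι] {e z : ι → ℝ}
    (h : ∀ s : ℝ, euclNorm (e - z) ^ 2 ≤ euclNorm (e - s • z) ^ 2) : z ⬝ᵥ e = z ⬝ᵥ z := by
  have hs : ∀ s : ℝ, z ⬝ᵥ z - 2 * (z ⬝ᵥ e) ≤ s ^ 2 * (z ⬝ᵥ z) - 2 * s * (z ⬝ᵥ e) := fun s => by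
    have := h s
    simp only [← dotProduct_self_eq, sub_dotProduct, dotProduct_sub, smul_dotProduct,
      dotProduct_smul, smul_eq_mul, dotProduct_comm e z] at this
    linarith
  have hz : 0 ≤ z ⬝ᵥ z := by rw [dotProduct_self_eq]; positivity
  rcases hz.eq_or_lt with h0 | h0
  · have : z = 0 := by simpa using h0.symm
    simp [this]
  · have := hs (z ⬝ᵥ e / z ⬝ᵥ z)
    have h2 : (z ⬝ᵥ e - z ⬝ᵥ z) ^ 2 ≤ 0 := by
      field_simp at this
      nlinarith
    have h3 := pow_eq_zero_iff (two_ne_zero) |>.mp (le_antisymm h2 (sq_nonneg _))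
    linarith

/-- The estimation error lies in the range of `R`, and its coordinates satisfy the normal equation
tested against themselves; invertibility of the Gram matrix is not used. -/
theorem IsOLS.exists_dotProduct_eq {X : Matrix (Fin n) (Fin d) ℝ} {Y E : Matrix (Fin n) (Fin q) ℝ}
    {Astar : Matrix (Fin q) (Fin d) ℝ} (hY : ∀ t, Y t = Astar *ᵥ X t + E t)
    {R : Matrix (Fin q × Fin d) (Fin m) ℝ} {γ b : Fin q × Fin d → ℝ} {θ₀ : Fin m → ℝ}
    (hθ : R *ᵥ θ₀ + γ = vec Astarᵀ) (h : IsOLS X Y R γ b) :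
    ∃ u : Fin m → ℝ, b - vec Astarᵀ = R *ᵥ u ∧
      u ⬝ᵥ (designMatrix X R)ᵀ *ᵥ vec E =
        u ⬝ᵥ ((designMatrix X R)ᵀ * designMatrix X R) *ᵥ u := by
  obtain ⟨θ, rfl, hmin⟩ := h
  have hvec : vec Y = ((1 : Matrix (Fin q) (Fin q) ℝ) ⊗ₖ X) *ᵥ vec Astarᵀ + vec E := by
    ext p
    rw [Pi.add_apply, one_kronecker_mulVec]
    simp only [vec, hY, Pi.add_apply, mulVec]
    rw [dotProduct_comm]
    rfl
  have hres : ∀ θ', vec Y - ((1 : Matrix (Fin q) (Fin q) ℝ) ⊗ₖ X) *ᵥ γ - designMatrix X R *ᵥ θ' =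
      vec E - designMatrix X R *ᵥ (θ' - θ₀) := fun θ' => by
    rw [hvec, ← hθ, mulVec_add, mulVec_mulVec, ← designMatrix, mulVec_sub]
    abel
  refine ⟨θ - θ₀, by rw [← hθ, mulVec_sub]; abel, ?_⟩
  rw [dotProduct_mulVec, vecMul_transpose, ← mulVec_mulVec, dotProduct_mulVec _ (designMatrix X R)ᵀ,
    vecMul_transpose]
  refine dotProduct_eq_of_forall_euclNorm_le fun s => ?_
  have := hmin (θ₀ + s • (θ - θ₀))
  rw [hres, hres, add_sub_cancel_left, mulVec_smul] at this
  exact this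

theorem sum_fin_eq_sum_Icc {M : Type*} [AddCommMonoid M] (f : ℕ → M) (n : ℕ) :
    ∑ t : Fin n, f (t + 1) = ∑ t ∈ Finset.Icc 1 n, f t := by
  induction n with
  | zero => simp
  | succ n ih => rw [Fin.sum_univ_castSucc, Finset.sum_Icc_succ_top (by omega), ← ih]; simp

theorem sum_Icc_add {M : Type*} [AddCommMonoid M] (f : ℕ → M) (a k : ℕ) :
    ∑ t ∈ Finset.Icc 1 (a + k), f t =
      ∑ t ∈ Finset.Icc 1 a, f t + ∑ t ∈ Finset.Icc 1 k, f (a + t) := by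
  induction k with
  | zero => simp
  | succ k ih =>
    rw [← add_assoc, Finset.sum_Icc_succ_top (by omega), ih, Finset.sum_Icc_succ_top (by omega),
      add_assoc, add_assoc]

theorem sum_blocks_le {f : ℕ → ℝ} (hf : ∀ t, 0 ≤ f t) {B k n : ℕ} (h : B * k ≤ n) :
    ∑ j ∈ Finset.range B, ∑ t ∈ Finset.Icc 1 k, f (j * k + t) ≤ ∑ t ∈ Finset.Icc 1 n, f t := by
  have hB : ∀ B : ℕ, ∑ j ∈ Finset.range B, ∑ t ∈ Finset.Icc 1 k, f (j * k + t) =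
      ∑ t ∈ Finset.Icc 1 (B * k), f t := fun B => by
    induction B with
    | zero => simp
    | succ B ih => rw [Finset.sum_range_succ, ih, Nat.succ_mul, sum_Icc_add]
  rw [hB]
  exact Finset.sum_le_sum_of_subset_of_nonneg (Finset.Icc_subset_Icc le_rfl h) fun t _ _ => hf t

theorem gram_quadratic (x : ℕ → Fin d → ℝ) (R : Matrix (Fin q × Fin d) (Fin m) ℝ)
    (v : Fin m → ℝ) :
    v ⬝ᵥ ((designMatrix (dataMatrix n x) R)ᵀ * designMatrix (dataMatrix n x) R) *ᵥ v =
      ∑ t ∈ Finset.Icc 1 n, ∑ i, (rowsOf (R *ᵥ v) i ⬝ᵥ x t) ^ 2 := by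
  rw [← mulVec_mulVec, dotProduct_mulVec, vecMul_transpose, dotProduct, Fintype.sum_prod_type_right]
  rw [← sum_fin_eq_sum_Icc (fun t => ∑ i, (rowsOf (R *ᵥ v) i ⬝ᵥ x t) ^ 2)]
  refine Finset.sum_congr rfl fun t _ => Finset.sum_congr rfl fun i _ => ?_
  rw [designMatrix_mulVec, sq, dotProduct_comm]; rfl

theorem score_dotProduct (x : ℕ → Fin d → ℝ) (e : ℕ → Fin q → ℝ)
    (R : Matrix (Fin q × Fin d) (Fin m) ℝ) (v : Fin m → ℝ) :
    v ⬝ᵥ (designMatrix (dataMatrix n x) R)ᵀ *ᵥ vec (dataMatrix n e) =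
      ∑ t ∈ Finset.Icc 1 n, (fun i => rowsOf (R *ᵥ v) i ⬝ᵥ x t) ⬝ᵥ e t := by
  rw [dotProduct_mulVec, vecMul_transpose, dotProduct, Fintype.sum_prod_type_right]
  rw [← sum_fin_eq_sum_Icc (fun t => (fun i => rowsOf (R *ᵥ v) i ⬝ᵥ x t) ⬝ᵥ e t)]
  refine Finset.sum_congr rfl fun t _ => Finset.sum_congr rfl fun i _ => ?_
  rw [designMatrix_mulVec, dotProduct_comm]; rfl

end Algebra

/-! ### The Gram matrix and the score of the regression -/

section Regression

theorem measurable_dotProduct_left {Ω : Type*} {d : ℕ} {m : MeasurableSpace Ω} {ξ : Ω → Fin d → ℝ}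
    (hξ : Measurable[m] ξ) (w : Fin d → ℝ) : Measurable[m] fun ω => w ⬝ᵥ ξ ω :=
  Finset.measurable_sum _ fun i _ => ((measurable_pi_apply i).comp hξ).const_mul (w i)

variable {Ω : Type*} [mΩ : MeasurableSpace Ω] {P : Measure Ω}
  {n q d m k : ℕ} {X : ℕ → Ω → Fin d → ℝ} {η : ℕ → Ω → Fin q → ℝ}
  {hX : ∀ t, Measurable (X t)} {hη : ∀ t, Measurable (η t)}

theorem measurable_dataFiltration_left {s t : ℕ} (h1 : 1 ≤ s) (hst : s ≤ t) :
    Measurable[dataFiltration X η hX hη t] (X s) := by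
  refine Measurable.mono (comap_measurable (X s)) ?_ le_rfl
  exact le_sup_of_le_right (le_iSup₂_of_le s ⟨h1, hst⟩ le_rfl)

theorem measurable_dataFiltration_right {s t : ℕ} (h1 : 1 ≤ s) (hst : s < t) :
    Measurable[dataFiltration X η hX hη t] (η s) := by
  refine Measurable.mono (comap_measurable (η s)) ?_ le_rfl
  exact le_sup_of_le_left (le_iSup₂_of_le s ⟨h1, hst⟩ le_rfl)

/-- The noise enters the score `Zᵀ vec(η)` at time `t` through the predictable multipliers
`(wᵢ · X_t)ᵢ`, where the `wᵢ` are the rows of the coefficient matrix of `R v`. -/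
theorem lintegral_exp_score_le_one [IsProbabilityMeasure P] {σ : ℝ}
    (hNoise : ∀ t ∈ Finset.Icc 1 n, IsCondCenteredSubGaussian P
      (dataFiltration X η hX hη t) σ (η t))
    (R : Matrix (Fin q × Fin d) (Fin m) ℝ) (v : Fin m → ℝ) :
    ∫⁻ ω, ENNReal.ofReal (Real.exp
      (v ⬝ᵥ (designMatrix (dataMatrix n fun t => X t ω) R)ᵀ *ᵥ vec (dataMatrix n fun t => η t ω) -
        σ ^ 2 / 2 * (v ⬝ᵥ ((designMatrix (dataMatrix n fun t => X t ω) R)ᵀ *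
          designMatrix (dataMatrix n fun t => X t ω) R) *ᵥ v))) ∂P ≤ 1 := by
  refine le_trans (le_of_eq ?_) (lintegral_exp_sum_le_one hNoise hη
    (fun t ht => measurable_dataFiltration_right ht t.lt_succ_self)
    (a := fun t ω i => rowsOf (R *ᵥ v) i ⬝ᵥ X t ω) fun t ht => ?_)
  · refine lintegral_congr fun ω => ?_
    rw [score_dotProduct, gram_quadratic, Finset.mul_sum, ← Finset.sum_sub_distrib]
    simp only [dotProduct, sq]
  · exact @measurable_pi_lambda _ _ _ (dataFiltration X η hX hη t) _ _ fun i =>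
      measurable_dotProduct_left (measurable_dataFiltration_left (Finset.mem_Icc.mp ht).1 le_rfl) _

/-- The small-ball condition, assumed for unit vectors, is homogeneous in the direction. -/
theorem IsVectorBMSB.ae_le {F : Filtration ℕ mΩ} {Γ : Matrix (Fin d) (Fin d) ℝ} {α : ℝ}
    (h : IsVectorBMSB P F n k Γ α X) {w : Fin d → ℝ} (hw : w ≠ 0) {s : ℕ} (hs : s + k ≤ n) :
    ∀ᵐ ω ∂P, α ≤ (k : ℝ)⁻¹ * ∑ t ∈ Finset.Icc 1 k,
      (P⟦{ω' | √(w ⬝ᵥ Γ *ᵥ w) ≤ |w ⬝ᵥ X (s + t) ω'|} | F s⟧) ω := by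
  have hr : 0 < euclNorm w := by
    rw [euclNorm, norm_pos_iff]
    simpa using hw
  set r := euclNorm w with hrdef
  have hunit : euclNorm (r⁻¹ • w) = 1 := by
    rw [euclNorm, WithLp.toLp_smul, norm_smul, ← euclNorm, ← hrdef,
      Real.norm_of_nonneg (by positivity), inv_mul_cancel₀ hr.ne']
  have hb := (h.2.2.2.2 _ hunit).2.2.2.2.2 s hs
  have hset : ∀ t, {ω' | √((r⁻¹ • w) ⬝ᵥ Γ *ᵥ (r⁻¹ • w)) ≤ |(r⁻¹ • w) ⬝ᵥ X (s + t) ω'|} =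
      {ω' | √(w ⬝ᵥ Γ *ᵥ w) ≤ |w ⬝ᵥ X (s + t) ω'|} := fun t => by
    ext ω'
    simp only [Set.mem_ofPred_eq, mulVec_smul, dotProduct_smul, smul_dotProduct, smul_eq_mul]
    rw [← mul_assoc, Real.sqrt_mul (by positivity), Real.sqrt_mul_self (by positivity), abs_mul,
      abs_of_pos (inv_pos.mpr hr), mul_le_mul_iff_right₀ (inv_pos.mpr hr)]
  simpa only [hset] using hb

/-- Small-ball bound for a fixed direction. The statistic attached to a block is the average over
the rows of the coefficient matrix, weighted by their share of the quadratic form, of the fraction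
of times at which the row is excited; hence all rows are treated at once. -/
theorem measure_gram_le [IsProbabilityMeasure P] {Γ : Matrix (Fin d) (Fin d) ℝ} {α : ℝ}
    (hΓ : Γ.PosDef) (hB : IsVectorBMSB P (dataFiltration X η hX hη) n k Γ α X)
    {R : Matrix (Fin q × Fin d) (Fin m) ℝ} (hR : Function.Injective R.mulVec) (κ : ℝ)
    {u : Fin m → ℝ} (hu : u ≠ 0) :
    P {ω | u ⬝ᵥ ((designMatrix (dataMatrix n fun t => X t ω) R)ᵀ *
        designMatrix (dataMatrix n fun t => X t ω) R) *ᵥ u ≤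
          κ * (u ⬝ᵥ restrictedGram Γ R *ᵥ u)} ≤
      ENNReal.ofReal (Real.exp (κ / k - α * (n / k : ℕ) / 2)) := by
  have hk : 0 < (k : ℝ) := by exact_mod_cast hB.1
  set F := dataFiltration X η hX hη with hF
  set w : Fin q → Fin d → ℝ := rowsOf (R *ᵥ u) with hw
  set g : Fin q → ℝ := fun i => w i ⬝ᵥ Γ *ᵥ w i with hg
  have hg0 : ∀ i, 0 ≤ g i := fun i => by
    simpa using hΓ.posSemidef.dotProduct_mulVec_nonneg (w i)
  set T : ℝ := u ⬝ᵥ restrictedGram Γ R *ᵥ u with hT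
  have hTsum : T = ∑ i, g i := restrictedGram_quadratic Γ R u
  have hTpos : 0 < T := by
    simpa using (restrictedGram_posDef hΓ hR).dotProduct_mulVec_pos hu
  set A : Fin q → ℕ → Set Ω := fun i t => {ω | √(g i) ≤ |w i ⬝ᵥ X t ω|} with hA
  have hAF : ∀ i s t, 1 ≤ s → s ≤ t → MeasurableSet[F t] (A i s) := fun i s t h1 hst => by
    have h := measurable_dotProduct_left
      (measurable_dataFiltration_left (X := X) (η := η) (hX := hX) (hη := hη) h1 hst) (w i)
    exact measurableSet_le measurable_const (continuous_abs.measurable.comp h)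
  have hAm : ∀ i s, 1 ≤ s → MeasurableSet (A i s) := fun i s h1 => F.le s _ (hAF i s s h1 le_rfl)
  set U : ℕ → Ω → ℝ := fun j => ∑ i, (g i / T) • ((k : ℝ)⁻¹ •
    ∑ t ∈ Finset.Icc 1 k, (A i (j * k + t)).indicator fun _ => (1 : ℝ)) with hU
  have hUapp : ∀ j ω, U j ω = ∑ i, g i / T * ((k : ℝ)⁻¹ *
      ∑ t ∈ Finset.Icc 1 k, (A i (j * k + t)).indicator (fun _ => (1 : ℝ)) ω) := fun j ω => by
    simp [hU, Finset.sum_apply]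
  have hi0 : ∀ i t ω, 0 ≤ (A i t).indicator (fun _ => (1 : ℝ)) ω := fun i t ω =>
    Set.indicator_nonneg (fun _ _ => zero_le_one) ω
  have hi1 : ∀ i t ω, (A i t).indicator (fun _ => (1 : ℝ)) ω ≤ 1 := fun i t ω =>
    Set.indicator_le_self' (fun _ _ => zero_le_one) ω
  have hgT : ∀ i, 0 ≤ g i / T := fun i => div_nonneg (hg0 i) hTpos.le
  have hgT1 : ∑ i, g i / T = 1 := by rw [← Finset.sum_div, ← hTsum, div_self hTpos.ne']
  have hU0 : ∀ j < n / k, ∀ ω, 0 ≤ U j ω := fun j _ ω => by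
    rw [hUapp]
    exact Finset.sum_nonneg fun i _ => mul_nonneg (hgT i)
      (mul_nonneg (inv_nonneg.mpr hk.le) (Finset.sum_nonneg fun t _ => hi0 _ _ _))
  have hU1 : ∀ j < n / k, ∀ ω, U j ω ≤ 1 := fun j _ ω => by
    rw [hUapp]
    refine (Finset.sum_le_sum fun i _ => mul_le_of_le_one_right (hgT i) ?_).trans hgT1.le
    rw [inv_mul_le_iff₀ hk, mul_one]
    refine (Finset.sum_le_sum fun t _ => hi1 _ _ _).trans ?_
    simp
  have hUm : ∀ j < n / k, Measurable[F ((j + 1) * k)] (U j) := fun j _ => by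
    rw [funext (hUapp j)]
    refine Finset.measurable_sum _ fun i _ => Measurable.const_mul
      (Measurable.const_mul (Finset.measurable_sum _ fun t ht => ?_) _) _
    rw [Finset.mem_Icc] at ht
    exact measurable_const.indicator (hAF i _ _ (by omega) (by rw [Nat.succ_mul]; omega))
  have hUα : ∀ j < n / k, ∀ᵐ ω ∂P, α ≤ (P[U j | F (j * k)]) ω := fun j hj => by
    have hjk : j * k + k ≤ n := by
      rw [← Nat.succ_mul]
      exact (Nat.mul_le_mul_right k hj).trans (Nat.div_mul_le_self n k)
    have hint : ∀ i, ∀ t ∈ Finset.Icc 1 k,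
        Integrable ((A i (j * k + t)).indicator fun _ => (1 : ℝ)) P := fun i t ht => by
      rw [Finset.mem_Icc] at ht
      exact (integrable_const _).indicator (hAm i _ (by omega))
    have hint' : ∀ i, Integrable (∑ t ∈ Finset.Icc 1 k,
        (A i (j * k + t)).indicator fun _ => (1 : ℝ)) P := fun i => integrable_finsetSum' _ (hint i)
    have h1 := condExp_finsetSum (μ := P) (s := Finset.univ)
      (fun i _ => ((hint' i).smul (k : ℝ)⁻¹).smul (g i / T)) (F (j * k))
    have h2 : ∀ i, P[(g i / T) • ((k : ℝ)⁻¹ • ∑ t ∈ Finset.Icc 1 k,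
        (A i (j * k + t)).indicator fun _ => (1 : ℝ)) | F (j * k)] =ᵐ[P]
        (g i / T) • ((k : ℝ)⁻¹ • ∑ t ∈ Finset.Icc 1 k,
          P[(A i (j * k + t)).indicator fun _ => (1 : ℝ) | F (j * k)]) := fun i => by
      refine (condExp_smul _ _ _).trans (Filter.EventuallyEq.const_smul ?_ _)
      refine (condExp_smul _ _ _).trans (Filter.EventuallyEq.const_smul ?_ _)
      exact condExp_finsetSum (hint i) _
    have h3 : ∀ i, ∀ᵐ ω ∂P, g i / T * α ≤ g i / T * ((k : ℝ)⁻¹ * ∑ t ∈ Finset.Icc 1 k,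
        (P[(A i (j * k + t)).indicator fun _ => (1 : ℝ) | F (j * k)]) ω) := fun i => by
      by_cases hwi : w i = 0
      · simp [hg, hwi]
      · filter_upwards [hB.ae_le hwi hjk] with ω hω
        exact mul_le_mul_of_nonneg_left hω (hgT i)
    filter_upwards [h1, ae_all_iff.mpr h2, ae_all_iff.mpr h3] with ω e1 e2 e3
    rw [hU, e1, Finset.sum_apply]
    calc α = ∑ i, g i / T * α := by rw [← Finset.sum_mul, hgT1, one_mul]
      _ ≤ _ := Finset.sum_le_sum fun i _ => (e3 i).trans (le_of_eq ?_)
    rw [e2 i]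
    simp [Finset.sum_apply]
  refine le_trans (measure_mono fun ω hω => ?_) (measure_sum_le_le (F := fun j => F (j * k))
    (fun i j hij => F.mono (Nat.mul_le_mul_right k hij)) (fun j => F.le _) hUm hU0 hU1 hUα (κ / k))
  simp only [Set.mem_ofPred_eq] at hω ⊢
  rw [gram_quadratic] at hω
  have hblock := sum_blocks_le (f := fun t => ∑ i, (w i ⬝ᵥ X t ω) ^ 2)
    (fun t => Finset.sum_nonneg fun i _ => sq_nonneg _) (Nat.div_mul_le_self n k)
  have hpt : ∀ j, k * T * U j ω ≤
      ∑ t ∈ Finset.Icc 1 k, ∑ i, (w i ⬝ᵥ X (j * k + t) ω) ^ 2 := fun j => by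
    rw [hUapp, Finset.sum_comm, Finset.mul_sum]
    refine Finset.sum_le_sum fun i _ => ?_
    have e : k * T * (g i / T * ((k : ℝ)⁻¹ *
        ∑ t ∈ Finset.Icc 1 k, (A i (j * k + t)).indicator (fun _ => (1 : ℝ)) ω)) =
        ∑ t ∈ Finset.Icc 1 k, g i * (A i (j * k + t)).indicator (fun _ => (1 : ℝ)) ω := by
      rw [← Finset.mul_sum]; field_simp
    rw [e]
    refine Finset.sum_le_sum fun t _ => ?_
    by_cases hmem : ω ∈ A i (j * k + t)
    · rw [Set.indicator_of_mem hmem, mul_one, ← sq_abs, ← Real.sq_sqrt (hg0 i)]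
      exact pow_le_pow_left₀ (Real.sqrt_nonneg _) hmem 2
    · rw [Set.indicator_of_notMem hmem, mul_zero]
      positivity
  have hsum : k * T * ∑ j ∈ Finset.range (n / k), U j ω ≤ κ * T := by
    rw [Finset.mul_sum]
    exact (Finset.sum_le_sum fun j _ => hpt j).trans (hblock.trans hω)
  rw [le_div_iff₀ hk]
  refine le_of_mul_le_mul_right ?_ hTpos
  linarith

end Regression

/-! ### Constants and exceptional events -/

/-- The sample size condition absorbs the volume ratio of `measure_not_lower_le` for `ε = α / 10`
and the Chernoff bound over `⌊n / k⌋` blocks for `κ = α² n / 20`. -/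
theorem exp_mul_covering_le {α δ D : ℝ} {n m k q : ℕ} (hα0 : 0 < α) (hα1 : α < 1) (hδ0 : 0 < δ)
    (hδ1 : δ < 1) (hD : 1 ≤ D) (hm : 1 ≤ m) (hk : 1 ≤ k)
    (hn : 9 * (k : ℝ) / α ^ 2 * (m * Real.log (27 / α) + 1 / 2 * Real.log D +
      Real.log q + Real.log (1 / δ)) ≤ n) :
    Real.exp (α ^ 2 * n / 20 / k - α * (n / k : ℕ) / 2) *
      (((1 + α / 10) / (α / 10)) ^ m * √D) ≤ δ := by
  have hk0 : (0 : ℝ) < k := by exact_mod_cast hk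
  have hm1 : (1 : ℝ) ≤ m := by exact_mod_cast hm
  have hD0 : 0 < D := by linarith
  set y : ℝ := (n : ℝ) / k with hy
  have hB : y - 1 ≤ (n / k : ℕ) := by
    have : n < (n / k + 1) * k := by
      rw [Nat.mul_comm]; exact Nat.lt_mul_div_succ n hk
    have h : (n : ℝ) < ((n / k : ℕ) + 1) * k := by exact_mod_cast this
    rw [← div_lt_iff₀ hk0] at h
    linarith
  have hLD := Real.log_nonneg hD
  have hq := Real.log_natCast_nonneg q
  have hLδ := Real.log_nonneg (one_le_one_div hδ0 hδ1.le)
  have h27 : 1 ≤ Real.log (27 / α) := by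
    rw [Real.le_log_iff_exp_le (by positivity), le_div_iff₀ hα0]
    have := Real.exp_one_lt_d9
    have := Real.exp_pos 1
    nlinarith
  have hlog : Real.log ((1 + α / 10) / (α / 10)) ≤ Real.log (27 / α) := by
    refine Real.log_le_log (by positivity) ?_
    rw [div_le_div_iff₀ (by positivity) hα0]
    nlinarith
  set S : ℝ := m * Real.log (27 / α) + 1 / 2 * Real.log D + Real.log q + Real.log (1 / δ) with hS
  have hm27 : (1 : ℝ) ≤ m * Real.log (27 / α) := one_le_mul_of_one_le_of_one_le hm1 h27
  have hyS : 9 * S ≤ α * y := by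
    have h1 : 9 * S ≤ α ^ 2 * y := by
      rw [hy, ← mul_div_assoc, le_div_iff₀ hk0]
      have h2 : 9 * (k : ℝ) / α ^ 2 * S = 9 * S * k / α ^ 2 := by ring
      rw [h2, div_le_iff₀ (by positivity)] at hn
      linarith
    have hy0 : 0 ≤ y := by positivity
    have : α ^ 2 * y ≤ α * y := by
      rw [sq, mul_assoc]
      exact mul_le_of_le_one_left (by positivity) hα1.le
    linarith
  have hexpo : α ^ 2 * n / 20 / k - α * (n / k : ℕ) / 2 ≤ -(9 / 20) * (α * y) + 1 / 2 := by
    have e : α ^ 2 * n / 20 / k = α * (α * y) / 20 := by rw [hy]; field_simp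
    have hy0 : 0 ≤ α * y := by positivity
    have h1 : α * (α * y) ≤ α * y := mul_le_of_le_one_left hy0 hα1.le
    have h2 := mul_le_mul_of_nonneg_left hB hα0.le
    rw [e]
    linarith
  have hrw : Real.exp (α ^ 2 * n / 20 / k - α * (n / k : ℕ) / 2) *
      (((1 + α / 10) / (α / 10)) ^ m * √D) =
      Real.exp (α ^ 2 * n / 20 / k - α * (n / k : ℕ) / 2 +
        (m * Real.log ((1 + α / 10) / (α / 10)) + Real.log D / 2)) := by
    rw [Real.exp_add, Real.exp_add, ← Real.log_sqrt hD0.le, Real.exp_log (Real.sqrt_pos.mpr hD0),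
      ← Real.log_pow, Real.exp_log (by positivity)]
  rw [hrw, ← Real.le_log_iff_exp_le hδ0]
  have hmlog := mul_le_mul_of_nonneg_left hlog (by linarith : (0 : ℝ) ≤ m)
  rw [one_div δ, Real.log_inv] at hS hLδ
  linarith

theorem det_smul_mul_inv {m : ℕ} (A B : Matrix (Fin m) (Fin m) ℝ) {a b : ℝ} :
    ((b • B) * (a • A)⁻¹).det = (b / a) ^ m * (B * A⁻¹).det := by
  simp only [det_mul, det_nonsing_inv, Ring.inverse_eq_inv', det_smul, Fintype.card_fin]
  rw [mul_inv, div_pow]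
  ring

theorem log_constant_le {α : ℝ} (hα0 : 0 < α) (hα1 : α < 1) :
    Real.log ((1 + α ^ 2 / 100) / (α ^ 2 / 100)) ≤ 2 * Real.log (14 / α) := by
  have h : (2 : ℝ) * Real.log (14 / α) = Real.log ((14 / α) ^ 2) := by rw [Real.log_pow]; norm_num
  rw [h]
  refine Real.log_le_log (by positivity) ?_
  rw [div_pow, div_le_div_iff₀ (by positivity) (by positivity)]
  have : α ^ 2 < 1 := by nlinarith
  nlinarith [sq_nonneg α]

theorem measurable_designMatrix {Ω : Type*} [MeasurableSpace Ω] {n q d m : ℕ}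
    {X : ℕ → Ω → Fin d → ℝ} (hX : ∀ t, Measurable (X t)) (R : Matrix (Fin q × Fin d) (Fin m) ℝ)
    (p : Fin q × Fin n) (i : Fin m) :
    Measurable fun ω => designMatrix (dataMatrix n fun t => X t ω) R p i := by
  have h : ∀ t j, Measurable fun ω => X t ω j := fun t j => (measurable_pi_apply j).comp (hX t)
  simp only [designMatrix, mul_apply, kroneckerMap_apply, dataMatrix, of_apply]
  fun_prop

theorem exists_measurableSet_forall_notMem {Ω : Type*} [MeasurableSpace Ω] {P : Measure Ω}
    [IsProbabilityMeasure P] {b₁ b₂ b₃ : Set Ω} {δ : ℝ} (hδ : 0 ≤ δ)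
    (h₁ : P b₁ ≤ ENNReal.ofReal δ) (h₂ : P b₂ ≤ ENNReal.ofReal δ)
    (h₃ : P b₃ ≤ ENNReal.ofReal δ) :
    ∃ E : Set Ω, MeasurableSet E ∧ 1 - 3 * δ ≤ P.real E ∧
      ∀ ω ∈ E, ω ∉ b₁ ∧ ω ∉ b₂ ∧ ω ∉ b₃ := by
  refine ⟨(toMeasurable P (b₁ ∪ b₂ ∪ b₃))ᶜ, (measurableSet_toMeasurable _ _).compl, ?_, ?_⟩
  · rw [probReal_compl_eq_one_sub (measurableSet_toMeasurable _ _), Measure.real,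
      measure_toMeasurable]
    have : P (b₁ ∪ b₂ ∪ b₃) ≤ ENNReal.ofReal (3 * δ) := by
      calc P (b₁ ∪ b₂ ∪ b₃) ≤ P b₁ + P b₂ + P b₃ :=
            (measure_union_le _ _).trans (add_le_add_left (measure_union_le _ _) _)
        _ ≤ ENNReal.ofReal δ + ENNReal.ofReal δ + ENNReal.ofReal δ := by gcongr
        _ = ENNReal.ofReal (3 * δ) := by
          rw [← ENNReal.ofReal_add hδ hδ, ← ENNReal.ofReal_add (by positivity) hδ]
          congr 1; ring
    have := ENNReal.toReal_le_of_le_ofReal (by positivity) this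
    linarith
  · intro ω hω
    have : ω ∉ b₁ ∪ b₂ ∪ b₃ := fun h => hω (subset_toMeasurable _ _ h)
    simpa [not_or, and_assoc] using this

end RestrictedRegression

open RestrictedRegression in
theorem theorem1 {Ω : Type*} [MeasurableSpace Ω] (P : Measure Ω) [IsProbabilityMeasure P]
    {n q d m k : ℕ} (hm : m ≤ q * d)
    -- the regression model
    (X : ℕ → Ω → Fin d → ℝ) (Y η : ℕ → Ω → Fin q → ℝ)
    (hX : ∀ t, Measurable (X t)) (hη : ∀ t, Measurable (η t))
    (Astar : Matrix (Fin q) (Fin d) ℝ)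
    (hY : ∀ t ∈ Finset.Icc 1 n, ∀ ω, Y t ω = Astar *ᵥ X t ω + η t ω)
    -- the linear restriction `C vec(Aᵀ) = c`
    (C : Matrix (Fin (q * d - m)) (Fin q × Fin d) ℝ) (c : Fin (q * d - m) → ℝ)
    (Cplus : Matrix (Fin m) (Fin q × Fin d) ℝ)
    (R : Matrix (Fin q × Fin d) (Fin m) ℝ)
    (Rplus : Matrix (Fin q × Fin d) (Fin (q * d - m)) ℝ)
    (hR : RestrictedRegression.IsRestriction C Cplus R Rplus)
    (hC : C *ᵥ vec Astarᵀ = c)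
    -- the regularity conditions
    (Γsb Γbar : Matrix (Fin d) (Fin d) ℝ) (α σ δ : ℝ) (hσ : 0 ≤ σ) (hδ0 : 0 < δ) (hδ1 : δ < 1)
    (hBMSB : RestrictedRegression.IsVectorBMSB P
      (RestrictedRegression.dataFiltration X η hX hη) n k Γsb α X)
    (hUpper : P {ω | ¬ ((n : ℝ) • RestrictedRegression.restrictedGram Γbar R -
        (RestrictedRegression.designMatrix
          (RestrictedRegression.dataMatrix n fun t => X t ω) R)ᵀ *
        RestrictedRegression.designMatrix
          (RestrictedRegression.dataMatrix n fun t => X t ω) R).PosSemidef} ≤ ENNReal.ofReal δ)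
    (hNoise : ∀ t ∈ Finset.Icc 1 n, RestrictedRegression.IsCondCenteredSubGaussian P
      (RestrictedRegression.dataFiltration X η hX hη t) σ (η t))
    (hΓsb : Γsb.PosDef) (hΓ : (Γbar - Γsb).PosSemidef)
    (hn : 9 * (k : ℝ) / α ^ 2 *
        (m * Real.log (27 / α) +
          1 / 2 * Real.log (RestrictedRegression.restrictedGram Γbar R *
            (RestrictedRegression.restrictedGram Γsb R)⁻¹).det +
          Real.log q + Real.log (1 / δ)) ≤ n) :
    ∃ E : Set Ω, MeasurableSet E ∧ 1 - 3 * δ ≤ P.real E ∧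
      ∀ ω ∈ E, ∀ βhat : Fin q × Fin d → ℝ,
        RestrictedRegression.IsOLS (RestrictedRegression.dataMatrix n fun t => X t ω)
          (RestrictedRegression.dataMatrix n fun t => Y t ω) R (Rplus *ᵥ c) βhat →
        RestrictedRegression.euclNorm (βhat - vec Astarᵀ) ≤
          9 * σ / α *
            √(RestrictedRegression.lambdaMax
                (R * (RestrictedRegression.restrictedGram Γsb R)⁻¹ * Rᵀ) / n *
              (12 * m * Real.log (14 / α) +
                9 * Real.log (RestrictedRegression.restrictedGram Γbar R *
                  (RestrictedRegression.restrictedGram Γsb R)⁻¹).det +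
                6 * Real.log (1 / δ))) := by
  have hθ : R *ᵥ (Cplus *ᵥ vec Astarᵀ) + Rplus *ᵥ c = vec Astarᵀ := by
    rw [← hC]; exact hR.mulVec_add_eq _
  have hrows : ∀ ω (t : Fin n), dataMatrix n (fun t => Y t ω) t =
      Astar *ᵥ dataMatrix n (fun t => X t ω) t + dataMatrix n (fun t => η t ω) t := fun ω t =>
    hY (t + 1) (Finset.mem_Icc.mpr ⟨by omega, t.2⟩) ω
  obtain ⟨hk, hα0, hα1, -⟩ := id hBMSB
  -- Without free parameters the estimator is exact, whatever the sample size.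
  rcases Nat.eq_zero_or_pos m with rfl | hm0
  · refine ⟨Set.univ, MeasurableSet.univ, by simp; positivity, fun ω _ b hb => ?_⟩
    obtain ⟨u, hu, -⟩ := hb.exists_dotProduct_eq (hrows ω) hθ
    have h0 : R *ᵥ u = 0 := by ext p; simp [mulVec, dotProduct]
    rw [hu, h0]
    have : euclNorm (0 : Fin q × Fin d → ℝ) = 0 := by simp [euclNorm]
    rw [this]
    positivity
  set A := restrictedGram Γsb R with hA
  set B := restrictedGram Γbar R with hB
  set G : Ω → Matrix (Fin m) (Fin m) ℝ := fun ω =>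
    (designMatrix (dataMatrix n fun t => X t ω) R)ᵀ *
      designMatrix (dataMatrix n fun t => X t ω) R with hG
  set S : Ω → Fin m → ℝ := fun ω =>
    (designMatrix (dataMatrix n fun t => X t ω) R)ᵀ *ᵥ vec (dataMatrix n fun t => η t ω) with hS
  have hApd : A.PosDef := restrictedGram_posDef hΓsb hR.injective
  have hBA : (B - A).PosSemidef := by
    rw [hA, hB, restrictedGram_sub]; exact restrictedGram_posSemidef R hΓ
  have hBpd : B.PosDef := by
    have := hApd.add_posSemidef hBA
    rwa [add_sub_cancel] at this
  have hD := one_le_det_mul_inv hApd hBpd hBA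
  set L := Real.log (B * A⁻¹).det with hL
  have hL0 : 0 ≤ L := Real.log_nonneg hD
  have hδL : 0 ≤ Real.log (1 / δ) := Real.log_nonneg (one_le_one_div hδ0 hδ1.le)
  have hm1 : (1 : ℝ) ≤ m := by exact_mod_cast hm0
  have h27 : 0 < Real.log (27 / α) := Real.log_pos (by rw [lt_div_iff₀ hα0]; linarith)
  have h14 : 0 < Real.log (14 / α) := Real.log_pos (by rw [lt_div_iff₀ hα0]; linarith)
  have hk0 : (0 : ℝ) < k := by exact_mod_cast hk
  have hn0 : (0 : ℝ) < n := by
    refine lt_of_lt_of_le ?_ hn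
    have := Real.log_natCast_nonneg q
    positivity
  have hZm := measurable_designMatrix (n := n) hX R
  have hGm : ∀ i j, Measurable fun ω => G ω i j := fun i j => by
    simp only [hG, mul_apply, transpose_apply]
    fun_prop
  have hSm : Measurable S := by
    refine measurable_pi_lambda _ fun i => ?_
    have : ∀ t j, Measurable fun ω => η t ω j := fun t j => (measurable_pi_apply j).comp (hη t)
    simp only [hS, mulVec, dotProduct, transpose_apply, vec, dataMatrix, of_apply]
    fun_prop
  have hGpsd : ∀ ω, (G ω).PosSemidef := fun ω => by
    have := posSemidef_conjTranspose_mul_self (designMatrix (dataMatrix n fun t => X t ω) R)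
    rwa [conjTranspose_eq_transpose_of_trivial] at this
  -- The regularizer `V` is the lower bound that the Gram matrix obeys with high probability, and
  -- `W` dominates `G + V` as soon as `G ≤ n B`.
  set a : ℝ := α ^ 2 / 100 * n with ha
  set V := a • A with hV
  set W := ((1 + α ^ 2 / 100) * n) • B with hW
  have ha0 : 0 < a := by positivity
  have hVpd : V.PosDef := hApd.smul ha0
  have hWpd : W.PosDef := hBpd.smul (by positivity)
  have hWV : W - V = (n : ℝ) • B + a • (B - A) := by
    rw [hW, hV, smul_sub, add_mul, one_mul, add_smul, ← ha]; abel
  -- Here `(√c + ε)² = α² / 25`, and `κ / N = α² / 20` leaves room for the factor `(1 - ε)²`.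
  have hlow := measure_not_lower_le (P := P) hGm hGpsd hApd hBpd hBA
    (N := n) (c := α ^ 2 / 100) (ε := α / 10) (κ := α ^ 2 * n / 20) hn0.le (by positivity)
    (by positivity) (by linarith) (by positivity) (by
      have : √(α ^ 2 / 100) = α / 10 := by
        rw [show α ^ 2 / 100 = (α / 10) ^ 2 by ring, Real.sqrt_sq (by positivity)]
      rw [this]
      have : (4 / 5 : ℝ) ≤ (1 - α / 10) ^ 2 := by nlinarith
      have := mul_le_mul_of_nonneg_left this (by positivity : 0 ≤ α ^ 2 * n / 20)
      linarith)
    fun u hu => measure_gram_le hΓsb hBMSB hR.injective _ hu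
  have hlow' := hlow.trans (ENNReal.ofReal_le_ofReal
    (exp_mul_covering_le hα0 hα1 hδ0 hδ1 hD hm0 hk hn))
  have hnoise := measure_selfNormalized_le (P := P) hSm hGm hGpsd hVpd hWpd
    (by rw [hWV]; exact (hBpd.posSemidef.smul hn0.le).add (hBA.smul ha0.le)) hσ hδ0 hδ1.le
    fun v => lintegral_exp_score_le_one hNoise R v
  obtain ⟨E, hEm, hEp, hE⟩ := exists_measurableSet_forall_notMem hδ0.le hUpper hlow' hnoise
  refine ⟨E, hEm, hEp, fun ω hω b hb => ?_⟩
  obtain ⟨h1, h2, h3⟩ := hE ω hω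
  have hup : ((n : ℝ) • B - G ω).PosSemidef := not_not.mp h1
  have hdown : (G ω - V).PosSemidef := by
    by_contra h
    exact h2 ⟨hup, h⟩
  have hWG : (W - (G ω + V)).PosSemidef := by
    have e : W - (G ω + V) = ((n : ℝ) • B - G ω) + a • (B - A) := by
      rw [add_comm, ← sub_sub, hWV]; abel
    rw [e]
    exact hup.add (hBA.smul ha0.le)
  obtain ⟨u, hu, huS⟩ := hb.exists_dotProduct_eq (hrows ω) hθ
  have hx : ∀ w : Fin m → ℝ, 2 * (w ⬝ᵥ S ω) - w ⬝ᵥ (G ω + V) *ᵥ w ≤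
      σ ^ 2 * (2 * Real.log (1 / δ) + Real.log (W * V⁻¹).det) := fun w => by
    by_contra! h
    exact h3 ⟨hWG, w, h⟩
  -- Half the error maximizes `2 λ uᵀ S - 2 λ² uᵀ G u` over multiples `λ u`, as `uᵀ S = uᵀ G u`, and
  -- `V ≤ G` lets `2 G` replace `G + V`.
  have hhalf := hx ((1 / 2 : ℝ) • u)
  have huS' : u ⬝ᵥ S ω = u ⬝ᵥ G ω *ᵥ u := huS
  have hVG := hdown.dotProduct_mulVec_nonneg u
  rw [star_trivial, sub_mulVec, dotProduct_sub] at hVG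
  simp only [mulVec_smul, dotProduct_smul, smul_dotProduct, smul_eq_mul, add_mulVec,
    dotProduct_add, huS'] at hhalf
  have hdet : Real.log (W * V⁻¹).det ≤ 2 * m * Real.log (14 / α) + L := by
    have hratio : (1 + α ^ 2 / 100) * n / a = (1 + α ^ 2 / 100) / (α ^ 2 / 100) := by
      rw [ha]; field_simp
    rw [hW, hV, det_smul_mul_inv, hratio, Real.log_mul (by positivity) (by linarith), Real.log_pow]
    have := mul_le_mul_of_nonneg_left (log_constant_le hα0 hα1) (by linarith : (0 : ℝ) ≤ m)
    linarith
  have hVu : u ⬝ᵥ V *ᵥ u = a * (u ⬝ᵥ A *ᵥ u) := by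
    rw [hV, smul_mulVec, dotProduct_smul, smul_eq_mul]
  set K : ℝ := 12 * m * Real.log (14 / α) + 9 * L + 6 * Real.log (1 / δ) with hK
  have hm14 : 0 ≤ m * Real.log (14 / α) := by positivity
  have hK0 : 0 ≤ K := by rw [hK, mul_assoc]; positivity
  have hσ2 : 0 ≤ σ ^ 2 := sq_nonneg σ
  have hau : a * (u ⬝ᵥ A *ᵥ u) ≤ 81 / 100 * σ ^ 2 * K := by
    have h4 := mul_le_mul_of_nonneg_left hdet hσ2
    have h5 : σ ^ 2 * (2 * (2 * Real.log (1 / δ) + (2 * m * Real.log (14 / α) + L))) ≤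
        σ ^ 2 * (81 / 100 * K) := by
      refine mul_le_mul_of_nonneg_left ?_ hσ2
      rw [hK]
      linarith
    rw [hVu] at hVG hhalf
    linarith
  have hl := lambdaMax_nonneg R hApd
  set lam := lambdaMax (R * A⁻¹ * Rᵀ) with hlam
  have hAu : u ⬝ᵥ A *ᵥ u ≤ 81 * σ ^ 2 / α ^ 2 * (K / n) := by
    rw [← le_div_iff₀' ha0] at hau
    refine hau.trans (le_of_eq ?_)
    rw [ha]
    field_simp
  have hsq : euclNorm (b - vec Astarᵀ) ^ 2 ≤ (9 * σ / α * √(lam / n * K)) ^ 2 := by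
    rw [mul_pow, Real.sq_sqrt (by positivity), hu, ← dotProduct_self_eq]
    refine (dotProduct_self_mulVec_le R hApd u).trans ?_
    refine (mul_le_mul_of_nonneg_left hAu hl).trans (le_of_eq ?_)
    ring
  exact le_of_sq_le_sq hsq (by positivity)
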